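/- Let $n\ge 1$, let $\mathbb{S}^{2n+1}$ be the unit sphere of $\mathbb{R}^{2n+2}=\mathbb{R}^{n+1}\times\mathbb{R}^{n+1}$, let $\Sigma_0=\mathbb{S}^n(1/\sqrt2)\times\mathbb{S}^n(1/\sqrt2)\subset\mathbb{S}^{2n+1}$ be the minimal Clifford torus, and let $\widehat\Sigma_0=\{rp : r>0,\ p\in\Sigma_0\}\subset\mathbb{R}^{2n+2}$ be the cone over it. Put $J=\begin{pmatrix}0&-\mathrm{Id}\\ \mathrm{Id}&0\end{pmatrix}$ with blocks of order $n+1$, and for $a,k>0$ consider the $a$-pitched twistings $$\Sigma(a,k)=\{(e^{ksJ}p,as) : p\in\Sigma_0,\ s\in\mathbb{R}\}\subset\mathbb{S}^{2n+1}\times\mathbb{R},\qquad \widehat\Sigma(a,k)=\{(e^{ksJ}p,as) : p\in\widehat\Sigma_0,\ s\in\mathbb{R}\}\subset\mathbb{R}^{2n+2}\times\mathbb{R}.$$ Definitions. Let $M$ be a Riemannian manifold, and let $M\times\mathbb{R}$ carry the product metric $\langle\,,\,\rangle=\langle\,,\,\rangle_M+dt^2$ with Levi-Civita connection $\overline\nabla$.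 For an orientable hypersurface $\Sigma\subset M\times\mathbb{R}$ with unit normal field $N$, let $AX=-\overline\nabla_XN$ be its shape operator, $H=\operatorname{trace}A$ its mean curvature, $\xi$ its height function (the restriction of $(x,t)\mapsto t$) and $\theta=\langle N,\partial_t\rangle$ its angle function. $\Sigma$ is a vertical helicoid if $\nabla\xi$ vanishes nowhere on $\Sigma$, $\theta$ is not constant, every horizontal section $\Sigma\cap(M\times\{t\})$ is a minimal hypersurface of $M\times\{t\}$, and $\langle A\nabla\xi,\nabla\xi\rangle=0$ on $\Sigma$. A hypersurface is spacelike if the Lorentzian metric $\langle\,,\,\rangle_L=\langle\,,\,\rangle_M-dt^2$ is positive definite on it; a spacelike hypersurface is zero mean isocurved if $H=0$ and $H_L=0$, where $H_L=\operatorname{trace}(X\mapsto\overline\nabla_XN_L)$ for a normal field $N_L$ with respect to $\langle\,,\,\rangle_L$ such that $\langle N_L,N_L\rangle_L=-1$. Then: 1. For all $a,k>0$, $\Sigma(a,k)$ is a properly embedded vertical helicoid in $\mathbb{S}^{2n+1}\times\mathbb{R}$. 2. For every $a>0$ there is $k>0$ such that $\Sigma(a,k)$ contains a nonempty open subset that is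 spacelike and zero mean isocurved in $\mathbb{S}^{2n+1}\times\mathbb{R}$. 3. For all $a,k>0$, $\widehat\Sigma(a,k)$ is an embedded vertical helicoid in $\mathbb{R}^{2n+2}\times\mathbb{R}$. 4. For every $a>0$ there is $k>0$ such that $\widehat\Sigma(a,k)$ contains a nonempty open subset that is spacelike and zero mean isocurved in $\mathbb{R}^{2n+2}\times\mathbb{R}$. -/

import Mathlib

open scoped ContDiff Topology RealInnerProductSpace

noncomputable section

/-! ### Submanifolds of a Euclidean vector space

Riemannian manifolds are realized as embedded submanifolds `P` of a finite-dimensional real inner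
product space `V`, with the induced metric. -/

section Submanifolds

variable {V : Type*} [NormedAddCommGroup V] [InnerProductSpace ℝ V] [FiniteDimensional ℝ V]

/-- `S` is a `d`-dimensional embedded `C^∞` submanifold of `V`: near each of its points it is the
zero set of a smooth map to `ℝ^c`, `c + d = dim V`, whose differential is onto along `S`. -/
def IsEmbeddedSubmanifold (S : Set V) (d : ℕ) : Prop :=
  ∃ c : ℕ, c + d = Module.finrank ℝ V ∧
    ∀ p ∈ S, ∃ U : Set V, IsOpen U ∧ p ∈ U ∧ ∃ f : V → EuclideanSpace ℝ (Fin c),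
      ContDiffOn ℝ ∞ f U ∧ (∀ q ∈ U, q ∈ S ↔ f q = 0) ∧
      ∀ q ∈ S ∩ U, Function.Surjective (fderiv ℝ f q)

/-- The tangent space of `S` at `p`: the space of velocities at `p` of smooth curves in `S`.
(For a submanifold the set of velocities is already a linear subspace.) -/
def tangentSpaceAt (S : Set V) (p : V) : Submodule ℝ V :=
  Submodule.span ℝ {v | ∃ γ : ℝ → V, ContDiffAt ℝ ∞ γ 0 ∧ (∀ᶠ t in 𝓝 (0 : ℝ), γ t ∈ S) ∧
    γ 0 = p ∧ HasDerivAt γ v 0}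

/-- `S` is an embedded hypersurface of the embedded submanifold `P`. -/
def IsEmbeddedHypersurface (P S : Set V) : Prop :=
  S ⊆ P ∧ ∃ d : ℕ, IsEmbeddedSubmanifold P (d + 1) ∧ IsEmbeddedSubmanifold S d

/-- The hypersurface `S` of `P` is properly embedded: the inclusion `S → P` is moreover proper. -/
def IsProperlyEmbeddedHypersurface (P S : Set V) : Prop :=
  IsEmbeddedHypersurface P S ∧ ∃ h : S ⊆ P, IsProperMap (Set.inclusion h)

/-- `N` restricts to a smooth vector field of `P` along `S`. -/
def IsSmoothFieldAlong (P S : Set V) (N : V → V) : Prop :=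
  (∃ U : Set V, IsOpen U ∧ S ⊆ U ∧ ContDiffOn ℝ ∞ N U) ∧ ∀ p ∈ S, N p ∈ tangentSpaceAt P p

/-- `N` is a smooth unit normal field of the hypersurface `S` of `P`. -/
def IsUnitNormalField (P S : Set V) (N : V → V) : Prop :=
  IsSmoothFieldAlong P S N ∧ ∀ p ∈ S, ‖N p‖ = 1 ∧ ∀ X ∈ tangentSpaceAt S p, ⟪X, N p⟫ = 0

/-- The Levi-Civita derivative of `P` at `p`, applied to a field `N`: the orthogonal projection to
`T_p P` of the derivative of `N` in `V`. It is used on directions tangent to `P`. -/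
def covariantDerivative (P : Set V) (N : V → V) (p : V) : V →L[ℝ] V :=
  (tangentSpaceAt P p).starProjection ∘L fderiv ℝ N p

/-- The shape operator `A X = -∇_X N` of the hypersurface `S` of `P`, as an endomorphism of `T_p S`.
For a unit normal `N` the vector `∇_X N` lies in `T_p S`, so that the projection to
`T_p S` only adjusts the codomain. -/
def shapeOperator (P S : Set V) (N : V → V) (p : V) :
    tangentSpaceAt S p →ₗ[ℝ] tangentSpaceAt S p :=
  -((tangentSpaceAt S p).orthogonalProjectionOnto ∘L covariantDerivative P N p ∘L
    (tangentSpaceAt S p).subtypeL).toLinearMap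

/-- The (non-normalized) mean curvature `H = trace A`. -/
def meanCurvature (P S : Set V) (N : V → V) (p : V) : ℝ :=
  LinearMap.trace ℝ (tangentSpaceAt S p) (shapeOperator P S N p)

/-- `S` is a minimal hypersurface of `P`: its mean curvature with respect to any local unit normal
field vanishes. -/
def IsMinimalHypersurface (P S : Set V) : Prop :=
  IsEmbeddedHypersurface P S ∧
    ∀ W : Set V, IsOpen W → ∀ N : V → V, IsUnitNormalField P (S ∩ W) N →
      ∀ p ∈ S ∩ W, meanCurvature P (S ∩ W) N p = 0

end Submanifolds

/-! ### Hypersurfaces of `M × ℝ`, for a submanifold `M` of a Euclidean vector space `E` -/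

section Product

variable {E : Type*} [NormedAddCommGroup E] [InnerProductSpace ℝ E] [FiniteDimensional ℝ E]

/-- `M × ℝ` inside the Euclidean product `E × ℝ`. -/
def cylinder (M : Set E) : Set (WithLp 2 (E × ℝ)) := {x | x.fst ∈ M}

/-- The horizontal section `M_t = M × {t}`. -/
def horizontalSlice (M : Set E) (t : ℝ) : Set (WithLp 2 (E × ℝ)) := {x | x.fst ∈ M ∧ x.snd = t}

/-- The vertical field `∂_t`. -/
def verticalVector : WithLp 2 (E × ℝ) := WithLp.toLp 2 (0, 1)

/-- The angle function `θ = ⟨N, ∂_t⟩`. -/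
def angleFunction (N : WithLp 2 (E × ℝ) → WithLp 2 (E × ℝ)) (p : WithLp 2 (E × ℝ)) : ℝ :=
  ⟪N p, verticalVector⟫

/-- The gradient on `S` of the height function, the restriction of `(x, t) ↦ t` to `S`: as `∂_t`
is the gradient of `(x, t) ↦ t`, this is the projection of `∂_t` to `T_p S`. -/
def heightGradient (S : Set (WithLp 2 (E × ℝ))) (p : WithLp 2 (E × ℝ)) : tangentSpaceAt S p :=
  (tangentSpaceAt S p).orthogonalProjectionOnto verticalVector

/-- `S` is a vertical helicoid of `M × ℝ`: an orientable hypersurface without horizontal points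
and with nonconstant angle function, whose horizontal sections are minimal in `M × {t}`, and for
which the gradient of the height function is an asymptotic direction. -/
structure IsVerticalHelicoid (M : Set E) (S : Set (WithLp 2 (E × ℝ))) : Prop where
  hypersurface : IsEmbeddedHypersurface (cylinder M) S
  orientable : ∃ N, IsUnitNormalField (cylinder M) S N
  no_horizontal_point : ∀ p ∈ S, heightGradient S p ≠ 0
  angle_nonconstant : ∀ N, IsUnitNormalField (cylinder M) S N →
    ∃ p ∈ S, ∃ q ∈ S, angleFunction N p ≠ angleFunction N q
  sections_minimal : ∀ t : ℝ,
    IsMinimalHypersurface (horizontalSlice M t) (horizontalSlice M t ∩ S)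
  asymptotic : ∀ N, IsUnitNormalField (cylinder M) S N → ∀ p ∈ S,
    ⟪shapeOperator (cylinder M) S N p (heightGradient S p), heightGradient S p⟫ = 0

/-- The Lorentzian product metric `⟨ , ⟩_M - dt²`. -/
def lorentzForm (X Y : WithLp 2 (E × ℝ)) : ℝ := ⟪X.fst, Y.fst⟫ - X.snd * Y.snd

/-- The Lorentzian metric is positive definite on `S`. -/
def IsSpacelike (S : Set (WithLp 2 (E × ℝ))) : Prop :=
  ∀ p ∈ S, ∀ X ∈ tangentSpaceAt S p, X ≠ 0 → 0 < lorentzForm X X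

/-- `N` is a smooth Lorentzian (timelike) unit normal field of the hypersurface `S` of `M × ℝ`. -/
def IsLorentzUnitNormalField (M : Set E) (S : Set (WithLp 2 (E × ℝ)))
    (N : WithLp 2 (E × ℝ) → WithLp 2 (E × ℝ)) : Prop :=
  IsSmoothFieldAlong (cylinder M) S N ∧
    ∀ p ∈ S, lorentzForm (N p) (N p) = -1 ∧ ∀ X ∈ tangentSpaceAt S p, lorentzForm X (N p) = 0

/-- The Lorentzian mean curvature `H_L = -trace A_L`, `A_L X = -∇_X N_L`. The Riemannian and the
Lorentzian product metrics of `M × ℝ` have the same Levi-Civita connection, and `∇_X N_L`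
again lies in `T_p S`, so `A_L` is given by the same formula as the Riemannian shape operator. -/
def lorentzMeanCurvature (M : Set E) (S : Set (WithLp 2 (E × ℝ)))
    (N : WithLp 2 (E × ℝ) → WithLp 2 (E × ℝ)) (p : WithLp 2 (E × ℝ)) : ℝ :=
  -LinearMap.trace ℝ (tangentSpaceAt S p) (shapeOperator (cylinder M) S N p)

/-- `S` is a spacelike zero mean isocurved hypersurface of `M × ℝ`: `H = H_L = 0` (for either
choice of unit normals). -/
structure IsZeroMeanIsocurved (M : Set E) (S : Set (WithLp 2 (E × ℝ))) : Prop where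
  hypersurface : IsEmbeddedHypersurface (cylinder M) S
  spacelike : IsSpacelike S
  orientable : ∃ N, IsUnitNormalField (cylinder M) S N
  lorentz_orientable : ∃ N, IsLorentzUnitNormalField M S N
  meanCurvature_eq_zero : ∀ N, IsUnitNormalField (cylinder M) S N →
    ∀ p ∈ S, meanCurvature (cylinder M) S N p = 0
  lorentzMeanCurvature_eq_zero : ∀ N, IsLorentzUnitNormalField M S N →
    ∀ p ∈ S, lorentzMeanCurvature M S N p = 0

/-- `S` contains a nonempty, relatively open, spacelike zero mean isocurved subset. -/
def ContainsOpenZeroMeanIsocurved (M : Set E) (S : Set (WithLp 2 (E × ℝ))) : Prop :=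
  ∃ W : Set (WithLp 2 (E × ℝ)), IsOpen W ∧ (S ∩ W).Nonempty ∧ IsZeroMeanIsocurved M (S ∩ W)

/-- The `a`-pitched twisting `{(Γ_s p, a s) : p ∈ S₀, s ∈ ℝ}` of `S₀` determined by `Γ`. -/
def pitchedTwisting (a : ℝ) (Γ : ℝ → E → E) (S₀ : Set E) : Set (WithLp 2 (E × ℝ)) :=
  {x | ∃ p ∈ S₀, ∃ s : ℝ, x = WithLp.toLp 2 (Γ s p, a * s)}

/-- The cone `{r p : r > 0, p ∈ S₀}` over `S₀`. -/
def coneOver (S₀ : Set E) : Set E := {x | ∃ r : ℝ, 0 < r ∧ ∃ p ∈ S₀, x = r • p}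

end Product

/-! ### Twisted Clifford tori -/

/-- `ℝ^{2n+2} = ℝ^{n+1} × ℝ^{n+1}`. -/
abbrev DoubleSpace (n : ℕ) : Type := EuclideanSpace ℝ (Fin (n + 1) ⊕ Fin (n + 1))

/-- The unit sphere `S^{2n+1}` of `ℝ^{2n+2}`. -/
def oddSphere (n : ℕ) : Set (DoubleSpace n) := Metric.sphere 0 1

/-- The Clifford torus `S^n(1/√2) × S^n(1/√2)`. -/
def cliffordTorus (n : ℕ) : Set (DoubleSpace n) :=
  {p | (WithLp.toLp 2 fun i => p (Sum.inl i) : EuclideanSpace ℝ (Fin (n + 1))) ∈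
        Metric.sphere 0 (1 / √2) ∧
      (WithLp.toLp 2 fun i => p (Sum.inr i) : EuclideanSpace ℝ (Fin (n + 1))) ∈
        Metric.sphere 0 (1 / √2)}

/-- The one-parameter group `s ↦ e^{(ks)J}` acting on `ℝ^{2n+2}`, where `J` is the block matrix
with rows `(0, -Id)` and `(Id, 0)`. -/
def rotationGroup (n : ℕ) (k s : ℝ) (p : DoubleSpace n) : DoubleSpace n :=
  Matrix.toEuclideanLin (NormedSpace.exp ((k * s) • Matrix.J (Fin (n + 1)) ℝ)) p

/-- The twisted Clifford torus `Σ(a, k)`. -/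
def twistedCliffordTorus (n : ℕ) (a k : ℝ) : Set (WithLp 2 (DoubleSpace n × ℝ)) :=
  pitchedTwisting a (rotationGroup n k) (cliffordTorus n)

/-- The twisting of the cone over the Clifford torus. -/
def twistedCliffordCone (n : ℕ) (a k : ℝ) : Set (WithLp 2 (DoubleSpace n × ℝ)) :=
  pitchedTwisting a (rotationGroup n k) (coneOver (cliffordTorus n))

end

/-! Let C(x, y) = (x, -y) and T(x, y) = (y, x). These are anticommuting symmetric involutions with T
∘ C = J, so conjugation by e^{θJ} turns C into A(2θ), where A(φ) = cos φ C + sin φ T. The Clifford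
torus is ⟨Cx, x⟩ = 0 on the sphere, and its cone is the same equation off the origin. Hence, with m
= 2k/a, both twistings are zero sets of F(x, t) = ½⟨A(mt)x, x⟩, over the sphere or over the
punctured space (`pitchedTwisting_eq`).

Write A' = A(· + π/2), the derivative of A. The gradient of F is (Ax, σ), with slope σ = (m/2)⟨A'x,
x⟩. Where F = 0, the Hessian has diagonal blocks A and 0 and off-diagonal part m A'x. It is
traceless because A anticommutes with the involution A'. It vanishes as a quadratic form on the
plane spanned by (Ax, 0) and ∂_t, because ⟨x, Ax⟩ = 0 and ⟨A'x, Ax⟩ = 0 (`inner_twistHessian`). That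
plane contains ∇F, its reflection in t, and ∇ξ.

Everything follows from these two facts. The second fundamental form is a multiple of the restricted
Hessian, so ∇ξ is asymptotic. The mean curvature is, up to a factor, the full trace minus the values
on normal directions, all of which are zero; the sphere adds only the normal (x, 0), on which the
Hessian is ⟨Ax, x⟩ = 0. Freezing t gives minimality of the sections. Reflecting t gives H_L = 0
(`trace_shapeOperator_indefinite`). The hypersurface is spacelike where |x|² < σ². Explicit torus
points with σ = 0 and σ = m/2 give a nonconstant angle and, when m > 2, a nonempty steep region. -/

/-! ### Regular level sets with orthogonal gradients: tangent spaces, projections, traces -/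

section LevelSets

variable {V : Type*} [NormedAddCommGroup V] [InnerProductSpace ℝ V]

/-- Maps that agree on `S` have the same derivative along tangent vectors of `S`. -/
theorem fderiv_eq_of_eqOn {F : Type*} [NormedAddCommGroup F] [NormedSpace ℝ F] {S : Set V} {p : V}
    {f g : V → F} (hf : DifferentiableAt ℝ f p) (hg : DifferentiableAt ℝ g p)
    (h : Set.EqOn f g S) {X : V} (hX : X ∈ tangentSpaceAt S p) :
    fderiv ℝ f p X = fderiv ℝ g p X := by
  have key : Set.EqOn (fderiv ℝ f p : V →ₗ[ℝ] F) (fderiv ℝ g p : V →ₗ[ℝ] F)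
      (tangentSpaceAt S p) := by
    refine LinearMap.eqOn_span ?_
    rintro v ⟨γ, -, hγS, rfl, hγ⟩
    have h1 := hf.hasFDerivAt.comp_hasDerivAt (0 : ℝ) hγ
    have h2 := hg.hasFDerivAt.comp_hasDerivAt (0 : ℝ) hγ
    refine h1.unique (h2.congr_of_eventuallyEq ?_)
    filter_upwards [hγS] with t ht using h ht
  exact key hX

/-- The tangent space of a regular level set is the kernel of the differential. -/
theorem tangentSpaceAt_eq_ker [FiniteDimensional ℝ V] {F : Type*} [NormedAddCommGroup F] [NormedSpace ℝ F]
    [FiniteDimensional ℝ F] {S : Set V} {p : V} {f : V → F} {f' : V →L[ℝ] F}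
    (hf : ContDiffAt ℝ ∞ f p) (hf' : HasFDerivAt f f' p) (hsurj : Function.Surjective f')
    (hp : p ∈ S) (hS : ∀ᶠ q in 𝓝 p, q ∈ S ↔ f q = 0) :
    tangentSpaceAt S p = LinearMap.ker (f' : V →ₗ[ℝ] F) := by
  have hfp : f p = 0 := hS.self_of_nhds.1 hp
  refine le_antisymm (Submodule.span_le.2 ?_) fun v hv => Submodule.subset_span ?_
  · rintro v ⟨γ, hγc, hγS, rfl, hγ⟩
    have h1 := hf'.comp_hasDerivAt (0 : ℝ) hγ
    refine h1.unique ((hasDerivAt_const (0 : ℝ) (0 : F)).congr_of_eventuallyEq ?_)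
    filter_upwards [hγS, hγ.continuousAt.eventually hS] with t h1 h2 using h2.1 h1
  · obtain ⟨r, hr⟩ := LinearMap.exists_rightInverse_of_surjective (f' : V →ₗ[ℝ] F)
      (LinearMap.range_eq_top.2 hsurj)
    have hr' : ∀ y, f' (r y) = y := fun y => LinearMap.congr_fun hr y
    let R : F →L[ℝ] V := LinearMap.toContinuousLinearMap r
    have hR : ∀ y, f' (R y) = y := hr'
    -- Since f' ∘ R = id, this map satisfies f' ∘ Φ = f, and its derivative at p is the identity.
    -- Its local inverse therefore straightens S: it sends the line t • v, for v in the kernel, to a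
    -- curve in S with velocity v.
    let Φ : V → V := fun q => (q - p) - R (f' (q - p)) + R (f q)
    have hΦc : ContDiffAt ℝ ∞ Φ p := by
      have : ContDiffAt ℝ ∞ (fun q => R (f q)) p := R.contDiff.contDiffAt.comp p hf
      refine ContDiffAt.add ?_ this
      fun_prop
    have hΦd : HasFDerivAt Φ ((ContinuousLinearEquiv.refl ℝ V : V ≃L[ℝ] V) : V →L[ℝ] V) p := by
      have h0 : HasFDerivAt (fun q : V => q - p) (ContinuousLinearMap.id ℝ V) p :=
        (hasFDerivAt_id p).sub_const p
      have h1 := (h0.sub ((R.comp f').hasFDerivAt.comp p h0)).add (R.hasFDerivAt.comp p hf')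
      refine h1.congr_fderiv ?_
      ext v
      simp
    have hn : (∞ : WithTop ℕ∞) ≠ 0 := by simp
    let Ψ := hΦc.localInverse hΦd hn
    have hΦp : Φ p = 0 := by simp [Φ, hfp]
    have hΨ0 : Ψ 0 = p := by rw [← hΦp]; exact hΦc.localInverse_apply_image hΦd hn
    have hst := hΦc.hasStrictFDerivAt' hΦd hn
    have hΨc : ContDiffAt ℝ ∞ Ψ 0 := by
      rw [← hΦp]; exact hΦc.to_localInverse hΦd hn
    have hright : ∀ᶠ y in 𝓝 (0 : V), Φ (Ψ y) = y := by
      have := hst.eventually_right_inverse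
      rwa [hΦp] at this
    have hΨd : HasFDerivAt Ψ (ContinuousLinearMap.id ℝ V) 0 := by
      have := hst.to_localInverse.hasFDerivAt
      rw [hΦp] at this
      exact this
    have hlin : HasDerivAt (fun t : ℝ => t • v) v 0 := by
      simpa using (hasDerivAt_id (0 : ℝ)).smul_const v
    have h0 : (fun t : ℝ => t • v) 0 = 0 := by simp
    have htend : Filter.Tendsto (fun t : ℝ => t • v) (𝓝 0) (𝓝 0) := by
      simpa using hlin.continuousAt.tendsto
    refine ⟨Ψ ∘ fun t => t • v, ?_, ?_, by simp [hΨ0], ?_⟩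
    · refine ContDiffAt.comp (0 : ℝ) (by rw [zero_smul]; exact hΨc) ?_
      fun_prop
    · have hΨt : Filter.Tendsto (fun t : ℝ => Ψ (t • v)) (𝓝 0) (𝓝 p) := by
        have := hΨc.continuousAt.tendsto.comp htend
        rwa [hΨ0] at this
      filter_upwards [htend.eventually hright, hΨt.eventually hS] with t h1 h2
      refine h2.2 ?_
      have h3 := congrArg f' h1
      have hv' : f' v = 0 := hv
      simpa [Φ, hR, hv'] using h3
    · have : HasFDerivAt Ψ (ContinuousLinearMap.id ℝ V) ((fun t : ℝ => t • v) 0) := by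
        rw [h0]; exact hΨd
      simpa using this.comp_hasDerivAt (0 : ℝ) hlin

/-- `S` is the common zero set in the open set `U` of the smooth functions `f i`, whose gradients
`w i` are nonzero and pairwise orthogonal along `S`. -/
structure IsOrthogonalLevelSet {c : ℕ} (S U : Set V) (f : Fin c → V → ℝ) (w : Fin c → V → V) :
    Prop where
  isOpen : IsOpen U
  subset : S ⊆ U
  contDiffOn : ∀ i, ContDiffOn ℝ ∞ (f i) U
  mem_iff : ∀ q ∈ U, q ∈ S ↔ ∀ i, f i q = 0
  hasFDerivAt : ∀ q ∈ S, ∀ i, HasFDerivAt (f i) (innerSL ℝ (w i q)) q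
  ne_zero : ∀ q ∈ S, ∀ i, w i q ≠ 0
  orthogonal : ∀ q ∈ S, ∀ i j, i ≠ j → ⟪w i q, w j q⟫ = 0

namespace IsOrthogonalLevelSet

variable {c : ℕ} {S U : Set V} {f : Fin c → V → ℝ} {w : Fin c → V → V}

theorem inter (h : IsOrthogonalLevelSet S U f w) {W : Set V} (hW : IsOpen W) :
    IsOrthogonalLevelSet (S ∩ W) (U ∩ W) f w where
  isOpen := h.isOpen.inter hW
  subset := Set.inter_subset_inter_left _ h.subset
  contDiffOn i := (h.contDiffOn i).mono Set.inter_subset_left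
  mem_iff q hq := by simp [hq.2, h.mem_iff q hq.1]
  hasFDerivAt q hq := h.hasFDerivAt q hq.1
  ne_zero q hq := h.ne_zero q hq.1
  orthogonal q hq := h.orthogonal q hq.1

/-- Imposing one more equation, with gradient orthogonal to the previous ones. -/
theorem cons (h : IsOrthogonalLevelSet S U f w) {U₀ S' : Set V} {f₀ : V → ℝ} {w₀ : V → V}
    (hU₀ : IsOpen U₀) (hS' : ∀ q, q ∈ S' ↔ q ∈ S ∧ q ∈ U₀ ∧ f₀ q = 0)
    (hf₀ : ContDiffOn ℝ ∞ f₀ U₀) (hw₀ : ∀ q ∈ S', HasFDerivAt f₀ (innerSL ℝ (w₀ q)) q)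
    (hne : ∀ q ∈ S', w₀ q ≠ 0) (hort : ∀ q ∈ S', ∀ i, ⟪w₀ q, w i q⟫ = 0) :
    IsOrthogonalLevelSet S' (U ∩ U₀) (Fin.cons f₀ f : Fin (c + 1) → V → ℝ)
      (Fin.cons w₀ w : Fin (c + 1) → V → V) where
  isOpen := h.isOpen.inter hU₀
  subset q hq := ⟨h.subset ((hS' q).1 hq).1, ((hS' q).1 hq).2.1⟩
  contDiffOn := by
    rw [Fin.forall_fin_succ]
    exact ⟨hf₀.mono Set.inter_subset_right,
      fun i => (h.contDiffOn i).mono Set.inter_subset_left⟩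
  mem_iff q hq := by
    rw [Fin.forall_fin_succ, hS' q, h.mem_iff q hq.1]
    simp [hq.2, and_comm]
  hasFDerivAt q hq := by
    rw [Fin.forall_fin_succ]
    exact ⟨hw₀ q hq, h.hasFDerivAt q ((hS' q).1 hq).1⟩
  ne_zero q hq := by
    rw [Fin.forall_fin_succ]
    exact ⟨hne q hq, h.ne_zero q ((hS' q).1 hq).1⟩
  orthogonal q hq i j hij := by
    induction i using Fin.cases with
    | zero =>
      induction j using Fin.cases with
      | zero => exact absurd rfl hij
      | succ j => simpa using hort q hq j
    | succ i =>
      induction j using Fin.cases with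
      | zero => simpa [real_inner_comm] using hort q hq i
      | succ j => simpa using h.orthogonal q ((hS' q).1 hq).1 i j (fun e => hij (by rw [e]))

theorem toLp_contDiffOn (h : IsOrthogonalLevelSet S U f w) :
    ContDiffOn ℝ ∞ (fun q => (WithLp.toLp 2 fun i => f i q : EuclideanSpace ℝ (Fin c))) U := by
  rw [contDiffOn_euclidean]
  exact h.contDiffOn

theorem toLp_hasFDerivAt (h : IsOrthogonalLevelSet S U f w) {p : V} (hp : p ∈ S) :
    HasFDerivAt (fun q => (WithLp.toLp 2 fun i => f i q : EuclideanSpace ℝ (Fin c)))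
      ((EuclideanSpace.equiv (Fin c) ℝ).symm.toContinuousLinearMap ∘L
        ContinuousLinearMap.pi fun i => innerSL ℝ (w i p)) p :=
  (EuclideanSpace.equiv (Fin c) ℝ).symm.toContinuousLinearMap.hasFDerivAt.comp p
    (hasFDerivAt_pi.2 (h.hasFDerivAt p hp))

theorem surjective (h : IsOrthogonalLevelSet S U f w) {p : V} (hp : p ∈ S) :
    Function.Surjective ((EuclideanSpace.equiv (Fin c) ℝ).symm.toContinuousLinearMap ∘L
        ContinuousLinearMap.pi fun i => innerSL ℝ (w i p)) := by
  intro y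
  -- Orthogonality of the gradients makes the differential diagonal on their span, so a preimage can
  -- be written down directly.
  refine ⟨∑ i, (y i / ⟪w i p, w i p⟫) • w i p, ?_⟩
  ext j
  have hj : ⟪w j p, w j p⟫ ≠ 0 := inner_self_ne_zero.2 (h.ne_zero p hp j)
  have : ⟪w j p, ∑ i, (y i / ⟪w i p, w i p⟫) • w i p⟫ = y j := by
    rw [inner_sum, Finset.sum_eq_single j]
    · rw [inner_smul_right, div_mul_cancel₀ _ hj]
    · intro i _ hij
      rw [inner_smul_right, h.orthogonal p hp j i hij.symm, mul_zero]
    · simp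
  exact this

theorem isEmbeddedSubmanifold (h : IsOrthogonalLevelSet S U f w) {d : ℕ}
    (hd : c + d = Module.finrank ℝ V) : IsEmbeddedSubmanifold S d := by
  refine ⟨c, hd, fun p hp => ⟨U, h.isOpen, h.subset hp, _, h.toLp_contDiffOn, fun q hq => ?_,
    fun q hq => ?_⟩⟩
  · rw [h.mem_iff q hq]
    constructor
    · intro h'
      ext i
      simpa using h' i
    · intro h' i
      simpa using congrArg (fun v : EuclideanSpace ℝ (Fin c) => v i) h'
  · rw [(h.toLp_hasFDerivAt hq.1).fderiv]
    exact h.surjective hq.1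

theorem mem_tangentSpaceAt_iff [FiniteDimensional ℝ V] (h : IsOrthogonalLevelSet S U f w) {p : V} (hp : p ∈ S) {X : V} :
    X ∈ tangentSpaceAt S p ↔ ∀ i, ⟪w i p, X⟫ = 0 := by
  have hU : U ∈ 𝓝 p := h.isOpen.mem_nhds (h.subset hp)
  rw [tangentSpaceAt_eq_ker (h.toLp_contDiffOn.contDiffAt hU) (h.toLp_hasFDerivAt hp)
    (h.surjective hp) hp, LinearMap.mem_ker]
  · constructor
    · intro h' i
      simpa using congrArg (fun v : EuclideanSpace ℝ (Fin c) => v i) h'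
    · intro h'
      ext i
      simpa using h' i
  · filter_upwards [hU] with q hq
    rw [h.mem_iff q hq]
    constructor
    · intro h'
      ext i
      simpa using h' i
    · intro h' i
      simpa using congrArg (fun v : EuclideanSpace ℝ (Fin c) => v i) h'

/-- Projecting to the tangent space amounts to removing the components along the gradients. -/
theorem starProjection_eq [FiniteDimensional ℝ V] (h : IsOrthogonalLevelSet S U f w) {p : V} (hp : p ∈ S) (v : V) :
    (tangentSpaceAt S p).starProjection v =
      v - ∑ i, (⟪w i p, v⟫ / ⟪w i p, w i p⟫) • w i p := by
  refine Submodule.eq_starProjection_of_mem_of_inner_eq_zero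
    ((h.mem_tangentSpaceAt_iff hp).2 fun j => ?_) fun X hX => ?_
  · have hj : ⟪w j p, w j p⟫ ≠ 0 := inner_self_ne_zero.2 (h.ne_zero p hp j)
    rw [inner_sub_right, inner_sum, Finset.sum_eq_single j]
    · rw [inner_smul_right, div_mul_cancel₀ _ hj, sub_self]
    · intro i _ hij
      rw [inner_smul_right, h.orthogonal p hp j i hij.symm, mul_zero]
    · simp
  · rw [sub_sub_cancel, sum_inner]
    refine Finset.sum_eq_zero fun i _ => ?_
    rw [real_inner_smul_left, (h.mem_tangentSpaceAt_iff hp).1 hX i, mul_zero]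

/-- The trace over the tangent space of the compression of an endomorphism. -/
theorem trace_compression [FiniteDimensional ℝ V] (h : IsOrthogonalLevelSet S U f w) {p : V} (hp : p ∈ S)
    (L : V →ₗ[ℝ] V) :
    LinearMap.trace ℝ (tangentSpaceAt S p)
      ((tangentSpaceAt S p).orthogonalProjectionOnto.toLinearMap ∘ₗ L ∘ₗ
        (tangentSpaceAt S p).subtype) =
      LinearMap.trace ℝ V L - ∑ i, ⟪L (w i p), w i p⟫ / ⟪w i p, w i p⟫ := by
  -- Cyclicity moves the trace to all of `V`, where the projection is the identity minus rank-one
  -- projections onto the gradients.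
  rw [LinearMap.trace_comp_comm']
  have : (L ∘ₗ (tangentSpaceAt S p).subtype) ∘ₗ
      (tangentSpaceAt S p).orthogonalProjectionOnto.toLinearMap =
      L - ∑ i, LinearMap.smulRight (innerSL ℝ (w i p)).toLinearMap
        ((1 / ⟪w i p, w i p⟫) • L (w i p)) := by
    ext v
    have h1 : ((tangentSpaceAt S p).orthogonalProjectionOnto v : V) =
      v - ∑ i, (⟪w i p, v⟫ / ⟪w i p, w i p⟫) • w i p := h.starProjection_eq hp v
    simp only [LinearMap.comp_apply, Submodule.subtype_apply, ContinuousLinearMap.coe_coe,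
      LinearMap.sub_apply, LinearMap.sum_apply, LinearMap.smulRight_apply, innerSL_apply_apply]
    rw [h1, map_sub, map_sum]
    congr 1
    refine Finset.sum_congr rfl fun i _ => ?_
    rw [map_smul, smul_smul, mul_one_div]
  rw [this, map_sub, map_sum]
  congr 1
  refine Finset.sum_congr rfl fun i _ => ?_
  rw [LinearMap.trace_smulRight]
  simp [real_inner_comm, div_eq_inv_mul]

end IsOrthogonalLevelSet

end LevelSets

/-! ### Shape operators of hypersurfaces, Riemannian and indefinite -/

section Hypersurfaces

variable {V : Type*} [NormedAddCommGroup V] [InnerProductSpace ℝ V]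
  {c : ℕ} {P S U U' : Set V} {f : Fin c → V → ℝ} {w : Fin c → V → V} {f₀ : V → ℝ} {g : V → V}

namespace IsOrthogonalLevelSet

theorem mem_tangentSpaceAt_cons_iff [FiniteDimensional ℝ V]
    (hS : IsOrthogonalLevelSet S U' (Fin.cons f₀ f : Fin (c + 1) → V → ℝ)
      (Fin.cons g w : Fin (c + 1) → V → V)) {p : V} (hp : p ∈ S) {X : V} :
    X ∈ tangentSpaceAt S p ↔ ⟪g p, X⟫ = 0 ∧ ∀ i, ⟪w i p, X⟫ = 0 := by
  rw [hS.mem_tangentSpaceAt_iff hp, Fin.forall_fin_succ]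
  simp

theorem tangentSpaceAt_le [FiniteDimensional ℝ V] (hP : IsOrthogonalLevelSet P U f w) (hSP : S ⊆ P)
    (hS : IsOrthogonalLevelSet S U' (Fin.cons f₀ f : Fin (c + 1) → V → ℝ)
      (Fin.cons g w : Fin (c + 1) → V → V)) {p : V} (hp : p ∈ S) :
    tangentSpaceAt S p ≤ tangentSpaceAt P p := fun _ hX =>
  (hP.mem_tangentSpaceAt_iff (hSP hp)).2 ((hS.mem_tangentSpaceAt_cons_iff hp).1 hX).2

/-- A vector tangent to `P` and normal to `S` is a multiple of the gradient `g`. -/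
theorem normal_eq_smul [FiniteDimensional ℝ V]
    (hS : IsOrthogonalLevelSet S U' (Fin.cons f₀ f : Fin (c + 1) → V → ℝ)
      (Fin.cons g w : Fin (c + 1) → V → V)) {p : V} (hp : p ∈ S) {ν : V}
    (hν : ∀ i, ⟪w i p, ν⟫ = 0) (hνS : ∀ X ∈ tangentSpaceAt S p, ⟪X, ν⟫ = 0) :
    ν = (⟪g p, ν⟫ / ⟪g p, g p⟫) • g p := by
  have h0 : (tangentSpaceAt S p).starProjection ν = 0 :=
    Submodule.starProjection_apply_eq_zero_iff _ |>.2 ((Submodule.mem_orthogonal _ _).2 hνS)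
  rw [hS.starProjection_eq hp, Fin.sum_univ_succ] at h0
  simp only [Fin.cons_zero, Fin.cons_succ, hν, zero_div, zero_smul, Finset.sum_const_zero,
    add_zero] at h0
  exact sub_eq_zero.1 h0

end IsOrthogonalLevelSet

/-- Projecting to the larger space T_p P first changes nothing once one projects to T_p S, so the
Levi-Civita derivative can be replaced by the flat one. -/
theorem shapeOperator_eq [FiniteDimensional ℝ V] {p : V} (hle : tangentSpaceAt S p ≤ tangentSpaceAt P p) (N : V → V) :
    shapeOperator P S N p = -((tangentSpaceAt S p).orthogonalProjectionOnto.toLinearMap ∘ₗ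
      (fderiv ℝ N p).toLinearMap ∘ₗ (tangentSpaceAt S p).subtype) := by
  ext X
  simp [shapeOperator, covariantDerivative,
    Submodule.orthogonalProjectionOnto_starProjection_of_le hle]

theorem inner_shapeOperator [FiniteDimensional ℝ V] {p : V} (hle : tangentSpaceAt S p ≤ tangentSpaceAt P p) (N : V → V)
    (X Y : tangentSpaceAt S p) :
    ⟪shapeOperator P S N p X, Y⟫ = -⟪fderiv ℝ N p X, (Y : V)⟫ := by
  rw [shapeOperator_eq hle]
  simp [inner_neg_left]

/-- The trace of the shape operator, computed from any endomorphism that differs from the derivative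
of the field by normal vectors. -/
theorem trace_shapeOperator [FiniteDimensional ℝ V] {p : V} (hS : IsOrthogonalLevelSet S U f w) (hp : p ∈ S)
    (hle : tangentSpaceAt S p ≤ tangentSpaceAt P p) (N : V → V) (L : V →ₗ[ℝ] V)
    (hL : ∀ X ∈ tangentSpaceAt S p, ∀ Y ∈ tangentSpaceAt S p,
      ⟪fderiv ℝ N p X, Y⟫ = ⟪L X, Y⟫) :
    LinearMap.trace ℝ (tangentSpaceAt S p) (shapeOperator P S N p) =
      -(LinearMap.trace ℝ V L - ∑ i, ⟪L (w i p), w i p⟫ / ⟪w i p, w i p⟫) := by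
  rw [← hS.trace_compression hp, shapeOperator_eq hle, map_neg]
  congr 2
  ext1 X
  refine ext_inner_right ℝ fun Y => ?_
  simpa using hL X X.2 Y Y.2

theorem IsSmoothFieldAlong.differentiableAt {N : V → V} (hN : IsSmoothFieldAlong P S N) {p : V}
    (hp : p ∈ S) : DifferentiableAt ℝ N p := by
  obtain ⟨⟨O, hO, hSO, hNO⟩, -⟩ := hN
  exact (hNO.contDiffAt (hO.mem_nhds (hSO hp))).differentiableAt (by simp)

theorem DifferentiableAt.inner_div_inner_self {G N : V → V} {p : V} (hG : DifferentiableAt ℝ G p)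
    (hN : DifferentiableAt ℝ N p) (h0 : ⟪G p, G p⟫ ≠ 0) :
    DifferentiableAt ℝ (fun q => ⟪G q, N q⟫ / ⟪G q, G q⟫) p := by
  have h1 : DifferentiableAt ℝ (fun q => ⟪G q, N q⟫) p := hG.inner ℝ hN
  have h2 : DifferentiableAt ℝ (fun q => ⟪G q, G q⟫) p := hG.inner ℝ hG
  simp only [div_eq_mul_inv]
  exact h1.fun_mul (h2.fun_inv h0)

/-- The derivative along `S` of a multiple of a field `G`. -/
theorem fderiv_eq_smul_add {N G : V → V} {b : V → ℝ} {p : V} {D : V →L[ℝ] V}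
    (hN : DifferentiableAt ℝ N p) (hb : DifferentiableAt ℝ b p) (hG : HasFDerivAt G D p)
    (h : ∀ q ∈ S, N q = b q • G q) {X : V} (hX : X ∈ tangentSpaceAt S p) :
    fderiv ℝ N p X = fderiv ℝ b p X • G p + b p • D X := by
  have h1 := hb.hasFDerivAt.smul hG
  rw [fderiv_eq_of_eqOn hN h1.differentiableAt (fun q hq => h q hq) hX, h1.fderiv]
  simp [add_comm]

namespace IsUnitNormalField

variable {N : V → V}

theorem eq_smul [FiniteDimensional ℝ V] (hN : IsUnitNormalField P S N) (hP : IsOrthogonalLevelSet P U f w) (hSP : S ⊆ P)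
    (hS : IsOrthogonalLevelSet S U' (Fin.cons f₀ f : Fin (c + 1) → V → ℝ)
      (Fin.cons g w : Fin (c + 1) → V → V)) {p : V} (hp : p ∈ S) :
    N p = (⟪g p, N p⟫ / ⟪g p, g p⟫) • g p :=
  hS.normal_eq_smul hp ((hP.mem_tangentSpaceAt_iff (hSP hp)).1 (hN.1.2 p hp)) (hN.2 p hp).2

/-- The second fundamental form is a multiple of the Hessian of the defining function. -/
theorem inner_fderiv [FiniteDimensional ℝ V] (hN : IsUnitNormalField P S N) (hP : IsOrthogonalLevelSet P U f w)
    (hSP : S ⊆ P) (hS : IsOrthogonalLevelSet S U' (Fin.cons f₀ f : Fin (c + 1) → V → ℝ)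
      (Fin.cons g w : Fin (c + 1) → V → V)) {p : V} (hp : p ∈ S) {D : V →L[ℝ] V}
    (hD : HasFDerivAt g D p) {X Y : V} (hX : X ∈ tangentSpaceAt S p)
    (hY : Y ∈ tangentSpaceAt S p) :
    ⟪fderiv ℝ N p X, Y⟫ = (⟪g p, N p⟫ / ⟪g p, g p⟫) * ⟪D X, Y⟫ := by
  have hg0 : ⟪g p, g p⟫ ≠ 0 := inner_self_ne_zero.2 (by simpa using hS.ne_zero p hp 0)
  have hg := hD.differentiableAt
  have hNd := hN.1.differentiableAt hp
  -- Along S the field is a function times g. Differentiating the function contributes only a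
  -- multiple of g, which is orthogonal to Y.
  rw [fderiv_eq_smul_add hNd (b := fun q => ⟪g q, N q⟫ / ⟪g q, g q⟫)
    (hg.inner_div_inner_self hNd hg0) hD
    (fun q hq => hN.eq_smul hP hSP hS hq) hX, inner_add_left, real_inner_smul_left, real_inner_smul_left,
    ((hS.mem_tangentSpaceAt_cons_iff hp).1 hY).1]
  simp

/-- The trace over T_p S is the full trace of the Hessian minus its values on the orthogonal normal
directions g and w i, suitably normalized; each term vanishes by assumption. -/
theorem meanCurvature_eq_zero [FiniteDimensional ℝ V] (hN : IsUnitNormalField P S N) (hP : IsOrthogonalLevelSet P U f w)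
    (hSP : S ⊆ P) (hS : IsOrthogonalLevelSet S U' (Fin.cons f₀ f : Fin (c + 1) → V → ℝ)
      (Fin.cons g w : Fin (c + 1) → V → V)) {p : V} (hp : p ∈ S) {D : V →L[ℝ] V}
    (hD : HasFDerivAt g D p) (htr : LinearMap.trace ℝ V D = 0) (hgg : ⟪D (g p), g p⟫ = 0)
    (hww : ∀ i, ⟪D (w i p), w i p⟫ = 0) : meanCurvature P S N p = 0 := by
  rw [meanCurvature, trace_shapeOperator hS hp (hP.tangentSpaceAt_le hSP hS hp) N
    ((⟪g p, N p⟫ / ⟪g p, g p⟫) • (D : V →ₗ[ℝ] V))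
    fun X hX Y hY => by
      simpa [real_inner_smul_left] using hN.inner_fderiv hP hSP hS hp hD hX hY]
  simp [Fin.sum_univ_succ, real_inner_smul_left, htr, hgg, hww]

end IsUnitNormalField

/-- The trace of the shape operator of a unit normal field with respect to the indefinite metric
`⟪·, R ·⟫`, for a self-adjoint `R`. -/
theorem trace_shapeOperator_indefinite [FiniteDimensional ℝ V] {N : V → V} {R : V →L[ℝ] V}
    (hR : ∀ X Y, ⟪R X, Y⟫ = ⟪X, R Y⟫) (hRR : ∀ X, R (R X) = X)
    (hN : IsSmoothFieldAlong P S N) (hP : IsOrthogonalLevelSet P U f w) (hSP : S ⊆ P)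
    (hS : IsOrthogonalLevelSet S U' (Fin.cons f₀ f : Fin (c + 1) → V → ℝ)
      (Fin.cons g w : Fin (c + 1) → V → V))
    (hRw : ∀ p ∈ S, ∀ i, R (w i p) = w i p)
    (hNN : ∀ p ∈ S, ⟪N p, R (N p)⟫ = -1)
    (hNX : ∀ p ∈ S, ∀ X ∈ tangentSpaceAt S p, ⟪X, R (N p)⟫ = 0)
    {p : V} (hp : p ∈ S) {D : V →L[ℝ] V}
    (hD : HasFDerivAt g D p) (htr : LinearMap.trace ℝ V ((R ∘L D : V →L[ℝ] V) : V →ₗ[ℝ] V) = 0)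
    (hgg : ⟪D (R (g p)), R (g p)⟫ = 0) (hww : ∀ i, ⟪D (w i p), w i p⟫ = 0) :
    LinearMap.trace ℝ (tangentSpaceAt S p) (shapeOperator P S N p) = 0 := by
  have hg0 : ⟪g p, g p⟫ ≠ 0 := inner_self_ne_zero.2 (by simpa using hS.ne_zero p hp 0)
  -- R N is Euclidean-normal to S, and tangent to P because R fixes the gradients w i. Hence it is a
  -- multiple of g, and N is the same multiple of R g.
  have hRN : ∀ q ∈ S, R (N q) = (⟪g q, R (N q)⟫ / ⟪g q, g q⟫) • g q := fun q hq =>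
    hS.normal_eq_smul hq (fun i => by
      rw [← hR, hRw q hq]
      exact (hP.mem_tangentSpaceAt_iff (hSP hq)).1 (hN.2 q hq) i) (hNX q hq)
  have hNeq : ∀ q ∈ S, N q = (⟪g q, R (N q)⟫ / ⟪g q, g q⟫) • R (g q) := fun q hq => by
    rw [← map_smul, ← hRN q hq, hRR]
  have hRg : HasFDerivAt (fun q => R (g q)) (R ∘L D) p := R.hasFDerivAt.comp p hD
  have hNd := hN.differentiableAt hp
  have hg := hD.differentiableAt
  obtain ⟨dc, hdc⟩ : ∃ dc : V → ℝ, ∀ X ∈ tangentSpaceAt S p,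
      fderiv ℝ N p X = dc X • R (g p) + (⟪g p, R (N p)⟫ / ⟪g p, g p⟫) • (R ∘L D) X :=
    ⟨_, fun X hX => fderiv_eq_smul_add hNd (b := fun q => ⟪g q, R (N q)⟫ / ⟪g q, g q⟫)
      (hg.inner_div_inner_self (R.differentiableAt.comp p hNd) hg0) hRg hNeq hX⟩
  set a : ℝ := ⟪g p, R (N p)⟫ / ⟪g p, g p⟫ with ha
  -- The normalization ⟪N, R N⟫ = -1 forces the factor a to be nonzero and g to be non-null, which
  -- permits division by ⟪g, R g⟫.
  have hunit : a * (a * ⟪g p, R (g p)⟫) = -1 := by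
    calc a * (a * ⟪g p, R (g p)⟫) = ⟪a • R (g p), a • g p⟫ := by
          rw [real_inner_smul_left, real_inner_smul_right, real_inner_comm]
      _ = ⟪N p, R (N p)⟫ := by rw [ha, ← hRN p hp, ← hNeq p hp]
      _ = -1 := hNN p hp
  have ha0 : a ≠ 0 := fun h => by simp [h] at hunit
  have hgL : ⟪g p, R (g p)⟫ ≠ 0 := fun h => by simp [h] at hunit
  -- Differentiating ⟪N, R N⟫ = -1 along S makes the derivative of N orthogonal to R N, hence to g.
  have hort : ∀ X ∈ tangentSpaceAt S p, ⟪fderiv ℝ N p X, g p⟫ = 0 := by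
    intro X hX
    have h1 := hNd.hasFDerivAt.inner ℝ (R.hasFDerivAt.comp p hNd.hasFDerivAt)
    have h2 := fderiv_eq_of_eqOn (S := S) h1.differentiableAt
      (differentiableAt_const (-1 : ℝ)) (fun q hq => hNN q hq) hX
    rw [h1.fderiv] at h2
    simp only [fderiv_fun_const, Pi.zero_apply, zero_apply,
      ContinuousLinearMap.comp_apply, ContinuousLinearMap.prod_apply,
      fderivInnerCLM_apply, Function.comp_apply] at h2
    rw [← hR, real_inner_comm, hRN p hp, ← ha, real_inner_smul_right] at h2
    have h3 : 2 * (a * ⟪fderiv ℝ N p X, g p⟫) = 0 := by linarith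
    simpa [ha0] using h3
  -- The R g component of the derivative of N is fixed by orthogonality to g. Removing it from a • R
  -- D gives a linear map on all of V that agrees with the derivative on T_p S and has image in the
  -- orthogonal complement of g.
  let L : V →ₗ[ℝ] V := a • (((R ∘L D : V →L[ℝ] V) : V →ₗ[ℝ] V) -
    LinearMap.smulRight ((innerSL ℝ (g p)).comp (R ∘L D)).toLinearMap
      ((1 / ⟪g p, R (g p)⟫) • R (g p)))
  have hLapply : ∀ X, L X = a • (R (D X) - (⟪g p, R (D X)⟫ / ⟪g p, R (g p)⟫) • R (g p)) := by
    intro X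
    simp [L, smul_smul, div_eq_mul_inv]
  have hLX : ∀ X ∈ tangentSpaceAt S p, fderiv ℝ N p X = L X := by
    intro X hX
    have h1 := hort X hX
    rw [hdc X hX, inner_add_left, real_inner_smul_left, real_inner_smul_left,
      real_inner_comm (g p) (R (g p)), real_inner_comm (g p)] at h1
    have h2 : dc X = -(a * (⟪g p, R (D X)⟫ / ⟪g p, R (g p)⟫)) := by
      have h1' : dc X * ⟪g p, R (g p)⟫ + a * ⟪g p, R (D X)⟫ = 0 := h1
      field_simp
      linarith
    rw [hdc X hX, hLapply, h2, smul_sub, smul_smul, neg_smul]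
    simp only [ContinuousLinearMap.comp_apply]
    abel
  rw [trace_shapeOperator hS hp (hP.tangentSpaceAt_le hSP hS hp) N L
    fun X hX Y _ => by rw [hLX X hX]]
  have hg : ⟪L (g p), g p⟫ = 0 := by
    rw [hLapply, real_inner_smul_left, inner_sub_left, real_inner_smul_left,
      real_inner_comm (g p) (R (g p)), div_mul_cancel₀ _ hgL, real_inner_comm (g p), sub_self,
      mul_zero]
  have hw : ∀ i, ⟪L (w i p), w i p⟫ = 0 := fun i => by
    have h1 : ⟪g p, w i p⟫ = 0 := by
      simpa using hS.orthogonal p hp 0 i.succ (Fin.succ_ne_zero i).symm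
    rw [hLapply, real_inner_smul_left, inner_sub_left, real_inner_smul_left, hR, hR, hRw p hp,
      hww, h1]
    simp
  have hLtr : LinearMap.trace ℝ V L = 0 := by
    have h1 : ⟪g p, R (D (R (g p)))⟫ = 0 := by rw [← hR, real_inner_comm]; exact hgg
    simp only [L, map_smul, map_sub, htr, LinearMap.trace_smulRight]
    simp [h1]
  simp [Fin.sum_univ_succ, hg, hw, hLtr]

end Hypersurfaces

/-! ### Clifford pairs, the twist function, its gradient and Hessian -/

section Twisting

theorem withLp_prod_ext {F : Type*} {X Y : WithLp 2 (F × ℝ)} (h₁ : X.fst = Y.fst) (h₂ : X.snd = Y.snd) :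
    X = Y := (WithLp.equiv 2 (F × ℝ)).injective (Prod.ext h₁ h₂)

variable {E : Type*} [NormedAddCommGroup E] [InnerProductSpace ℝ E]

theorem inner_withLp_prod (X Y : WithLp 2 (E × ℝ)) :
    ⟪X, Y⟫ = ⟪X.fst, Y.fst⟫ + X.snd * Y.snd := by
  rw [WithLp.prod_inner_apply]
  simp [mul_comm]

theorem finrank_withLp_prod [FiniteDimensional ℝ E] :
    Module.finrank ℝ (WithLp 2 (E × ℝ)) = Module.finrank ℝ E + 1 := by
  rw [(WithLp.linearEquiv 2 ℝ (E × ℝ)).finrank_eq]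
  simp

theorem trace_withLp_prod [FiniteDimensional ℝ E]
    (L : WithLp 2 (E × ℝ) →ₗ[ℝ] WithLp 2 (E × ℝ)) (A : E →ₗ[ℝ] E)
    (hA : ∀ v, (L (WithLp.toLp 2 (v, 0))).fst = A v) :
    LinearMap.trace ℝ _ L = LinearMap.trace ℝ E A + (L verticalVector).snd := by
  rw [LinearMap.trace_eq_sum_inner L
    ((stdOrthonormalBasis ℝ E).prod (OrthonormalBasis.singleton Unit ℝ)),
    LinearMap.trace_eq_sum_inner A (stdOrthonormalBasis ℝ E)]
  simp [hA, verticalVector]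

/-- The reflection `(x, t) ↦ (x, -t)`. -/
noncomputable def heightReflection : WithLp 2 (E × ℝ) →L[ℝ] WithLp 2 (E × ℝ) :=
  (WithLp.prodContinuousLinearEquiv 2 ℝ E ℝ).symm.toContinuousLinearMap ∘L
    (WithLp.fstL 2 ℝ E ℝ).prod (-WithLp.sndL 2 ℝ E ℝ)

@[simp] theorem heightReflection_fst (X : WithLp 2 (E × ℝ)) :
    (heightReflection X).fst = X.fst := rfl

@[simp] theorem heightReflection_snd (X : WithLp 2 (E × ℝ)) :
    (heightReflection X).snd = -X.snd := rfl

@[simp] theorem heightReflection_heightReflection (X : WithLp 2 (E × ℝ)) :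
    heightReflection (heightReflection X) = X :=
  withLp_prod_ext rfl (neg_neg _)

theorem lorentzForm_eq_inner (X Y : WithLp 2 (E × ℝ)) :
    lorentzForm X Y = ⟪X, heightReflection Y⟫ := by
  rw [inner_withLp_prod, lorentzForm]
  simp [sub_eq_add_neg]

/-- `C` and `T` are anticommuting orthogonal reflections. -/
structure IsCliffordPair (C T : E →L[ℝ] E) : Prop where
  symm_left : ∀ x y, ⟪C x, y⟫ = ⟪x, C y⟫
  symm_right : ∀ x y, ⟪T x, y⟫ = ⟪x, T y⟫
  sq_left : ∀ x, C (C x) = x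
  sq_right : ∀ x, T (T x) = x
  anticomm : ∀ x, C (T x) = -T (C x)

/-- The reflections interpolating between `C` and `T`. -/
noncomputable def rotatedReflection (C T : E →L[ℝ] E) (φ : ℝ) : E →L[ℝ] E :=
  Real.cos φ • C + Real.sin φ • T

variable {C T : E →L[ℝ] E}

theorem rotatedReflection_apply (φ : ℝ) (x : E) :
    rotatedReflection C T φ x = Real.cos φ • C x + Real.sin φ • T x := rfl

theorem rotatedReflection_quarter_apply (φ : ℝ) (x : E) :
    rotatedReflection C T (φ + Real.pi / 2) x = -Real.sin φ • C x + Real.cos φ • T x := by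
  rw [rotatedReflection_apply, Real.cos_add_pi_div_two, Real.sin_add_pi_div_two]

theorem hasDerivAt_rotatedReflection (φ : ℝ) :
    HasDerivAt (rotatedReflection C T) (rotatedReflection C T (φ + Real.pi / 2)) φ := by
  have := ((Real.hasDerivAt_cos φ).smul_const C).add ((Real.hasDerivAt_sin φ).smul_const T)
  rw [rotatedReflection, Real.cos_add_pi_div_two, Real.sin_add_pi_div_two]
  exact this

theorem contDiff_rotatedReflection : ContDiff ℝ ∞ (rotatedReflection C T) := by
  unfold rotatedReflection
  exact (Real.contDiff_cos.smul contDiff_const).add (Real.contDiff_sin.smul contDiff_const)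

/-- A quarter turn is differentiation in the angle, so this is A'' = -A. It gives the lower right
entry of `twistHessian`. -/
theorem rotatedReflection_half_turn (φ : ℝ) :
    rotatedReflection C T (φ + Real.pi / 2 + Real.pi / 2) = -rotatedReflection C T φ := by
  ext x
  rw [rotatedReflection_quarter_apply, Real.cos_add_pi_div_two, Real.sin_add_pi_div_two]
  simp [rotatedReflection_apply]
  abel

namespace IsCliffordPair

theorem symm (h : IsCliffordPair C T) (φ : ℝ) (x y : E) :
    ⟪rotatedReflection C T φ x, y⟫ = ⟪x, rotatedReflection C T φ y⟫ := by
  simp only [rotatedReflection_apply, inner_add_left, inner_add_right, real_inner_smul_left,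
    real_inner_smul_right, h.symm_left, h.symm_right]

theorem sq (h : IsCliffordPair C T) (φ : ℝ) (x : E) :
    rotatedReflection C T φ (rotatedReflection C T φ x) = x := by
  simp only [rotatedReflection_apply, map_add, map_smul, h.sq_left, h.sq_right, h.anticomm]
  have hx : (Real.cos φ ^ 2 + Real.sin φ ^ 2) • x = x := by
    rw [Real.cos_sq_add_sin_sq, one_smul]
  conv_rhs => rw [← hx]
  module

theorem anticomm_quarter (h : IsCliffordPair C T) (φ : ℝ) (x : E) :
    rotatedReflection C T φ (rotatedReflection C T (φ + Real.pi / 2) x) =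
      -rotatedReflection C T (φ + Real.pi / 2) (rotatedReflection C T φ x) := by
  rw [rotatedReflection_quarter_apply, rotatedReflection_quarter_apply]
  simp only [rotatedReflection_apply, map_add, map_smul, h.sq_left, h.sq_right, h.anticomm]
  module

/-- Two anticommuting symmetric maps have a skew product, so the quantity equals its own negative.
-/
theorem inner_quarter (h : IsCliffordPair C T) (φ : ℝ) (x : E) :
    ⟪rotatedReflection C T (φ + Real.pi / 2) x, rotatedReflection C T φ x⟫ = 0 := by
  have h1 : ⟪rotatedReflection C T (φ + Real.pi / 2) x, rotatedReflection C T φ x⟫ =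
      -⟪rotatedReflection C T (φ + Real.pi / 2) x, rotatedReflection C T φ x⟫ := by
    conv_lhs => rw [← h.symm, h.anticomm_quarter, inner_neg_left, h.symm, real_inner_comm]
  linarith

theorem inner_self (h : IsCliffordPair C T) (φ : ℝ) (x : E) :
    ⟪rotatedReflection C T φ x, rotatedReflection C T φ x⟫ = ⟪x, x⟫ := by
  rw [h.symm, h.sq]

theorem apply_ne_zero (h : IsCliffordPair C T) (φ : ℝ) {x : E} (hx : x ≠ 0) :
    rotatedReflection C T φ x ≠ 0 := fun h0 => hx (by rw [← h.sq φ x, h0, map_zero])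

/-- The quarter-turned reflection B is an involution anticommuting with A. Thus B A B = -A, and
conjugation preserves the trace. -/
theorem trace_eq_zero [FiniteDimensional ℝ E] (h : IsCliffordPair C T) (φ : ℝ) :
    LinearMap.trace ℝ E (rotatedReflection C T φ) = 0 := by
  set A := (rotatedReflection C T φ : E →ₗ[ℝ] E) with hA
  set B := (rotatedReflection C T (φ + Real.pi / 2) : E →ₗ[ℝ] E) with hB
  have h1 : (A ∘ₗ B) ∘ₗ B = A := by
    ext x
    simp [hA, hB, h.sq]
  have h2 : B ∘ₗ (A ∘ₗ B) = -A := by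
    ext x
    simp [hA, hB, h.anticomm_quarter, h.sq]
  have h3 := LinearMap.trace_comp_comm' (A ∘ₗ B) B
  rw [h1, h2, map_neg] at h3
  linarith

end IsCliffordPair

/-- The function `(x, t) ↦ ½ ⟪A x, x⟫`, where the reflection `A` rotates with speed `m` in `t`. -/
noncomputable def twistFunction (C T : E →L[ℝ] E) (m φ : ℝ) (p : WithLp 2 (E × ℝ)) : ℝ :=
  1 / 2 * ⟪rotatedReflection C T (m * p.snd + φ) p.fst, p.fst⟫

/-- The vertical part of the gradient of `twistFunction`. -/
noncomputable def twistSlope (C T : E →L[ℝ] E) (m φ : ℝ) (p : WithLp 2 (E × ℝ)) : ℝ :=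
  m / 2 * ⟪rotatedReflection C T (m * p.snd + φ + Real.pi / 2) p.fst, p.fst⟫

/-- The gradient of `twistFunction`. -/
noncomputable def twistGradient (C T : E →L[ℝ] E) (m φ : ℝ) (p : WithLp 2 (E × ℝ)) :
    WithLp 2 (E × ℝ) :=
  WithLp.toLp 2 (rotatedReflection C T (m * p.snd + φ) p.fst, twistSlope C T m φ p)

/-- The Hessian of `twistFunction`. -/
noncomputable def twistHessian (C T : E →L[ℝ] E) (m φ : ℝ) (p : WithLp 2 (E × ℝ)) :
    WithLp 2 (E × ℝ) →L[ℝ] WithLp 2 (E × ℝ) :=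
  (WithLp.prodContinuousLinearEquiv 2 ℝ E ℝ).symm.toContinuousLinearMap ∘L
    ContinuousLinearMap.prod
      (rotatedReflection C T (m * p.snd + φ) ∘L WithLp.fstL 2 ℝ E ℝ +
        (m • WithLp.sndL 2 ℝ E ℝ).smulRight
          (rotatedReflection C T (m * p.snd + φ + Real.pi / 2) p.fst))
      (m • (innerSL ℝ (rotatedReflection C T (m * p.snd + φ + Real.pi / 2) p.fst) ∘L
          WithLp.fstL 2 ℝ E ℝ) -
        (m ^ 2 / 2 * ⟪rotatedReflection C T (m * p.snd + φ) p.fst, p.fst⟫) •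
          WithLp.sndL 2 ℝ E ℝ)

variable (m φ : ℝ)

theorem twistHessian_apply_fst (p X : WithLp 2 (E × ℝ)) :
    (twistHessian C T m φ p X).fst = rotatedReflection C T (m * p.snd + φ) X.fst +
      (m * X.snd) • rotatedReflection C T (m * p.snd + φ + Real.pi / 2) p.fst := rfl

theorem twistHessian_apply_snd (p X : WithLp 2 (E × ℝ)) :
    (twistHessian C T m φ p X).snd =
      m * ⟪rotatedReflection C T (m * p.snd + φ + Real.pi / 2) p.fst, X.fst⟫ -
      m ^ 2 / 2 * ⟪rotatedReflection C T (m * p.snd + φ) p.fst, p.fst⟫ * X.snd := rfl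

theorem hasFDerivAt_rotatedReflection_apply (p : WithLp 2 (E × ℝ)) :
    HasFDerivAt (fun q : WithLp 2 (E × ℝ) => rotatedReflection C T (m * q.snd + φ) q.fst)
      (rotatedReflection C T (m * p.snd + φ) ∘L WithLp.fstL 2 ℝ E ℝ +
        (m • WithLp.sndL 2 ℝ E ℝ).smulRight
          (rotatedReflection C T (m * p.snd + φ + Real.pi / 2) p.fst)) p := by
  have h1 : HasFDerivAt (fun q : WithLp 2 (E × ℝ) => m * q.snd + φ)
      (m • WithLp.sndL 2 ℝ E ℝ) p :=
    ((WithLp.sndL 2 ℝ E ℝ).hasFDerivAt.const_mul m).add_const φ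
  have h2 := (hasDerivAt_rotatedReflection (C := C) (T := T)
    (m * p.snd + φ)).hasFDerivAt.comp p h1
  have h3 : HasFDerivAt (fun q : WithLp 2 (E × ℝ) => q.fst) (WithLp.fstL 2 ℝ E ℝ) p :=
    (WithLp.fstL 2 ℝ E ℝ).hasFDerivAt
  refine (h2.clm_apply h3).congr_fderiv ?_
  ext X
  simp [mul_smul]

theorem contDiff_rotatedReflection_apply :
    ContDiff ℝ ∞ (fun q : WithLp 2 (E × ℝ) => rotatedReflection C T (m * q.snd + φ) q.fst) := by
  have h1 : ContDiff ℝ ∞ (fun q : WithLp 2 (E × ℝ) => m * q.snd + φ) :=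
    (contDiff_const.mul (WithLp.sndL 2 ℝ E ℝ).contDiff).add contDiff_const
  exact (contDiff_rotatedReflection.comp h1).clm_apply (WithLp.fstL 2 ℝ E ℝ).contDiff

theorem contDiff_twistFunction : ContDiff ℝ ∞ (twistFunction C T m φ) :=
  contDiff_const.mul ((contDiff_rotatedReflection_apply m φ).inner ℝ
    (WithLp.fstL 2 ℝ E ℝ).contDiff)

theorem contDiff_twistSlope : ContDiff ℝ ∞ (twistSlope C T m φ) := by
  unfold twistSlope
  simp only [add_assoc]
  exact contDiff_const.mul ((contDiff_rotatedReflection_apply m (φ + Real.pi / 2)).inner ℝ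
    (WithLp.fstL 2 ℝ E ℝ).contDiff)

theorem contDiff_twistGradient : ContDiff ℝ ∞ (twistGradient C T m φ) :=
  (WithLp.prodContinuousLinearEquiv 2 ℝ E ℝ).symm.contDiff.comp
    ((contDiff_rotatedReflection_apply m φ).prodMk (contDiff_twistSlope m φ))

namespace IsCliffordPair

theorem hasFDerivAt_twistFunction (h : IsCliffordPair C T) (p : WithLp 2 (E × ℝ)) :
    HasFDerivAt (twistFunction C T m φ) (innerSL ℝ (twistGradient C T m φ p)) p := by
  have h3 : HasFDerivAt (fun q : WithLp 2 (E × ℝ) => q.fst) (WithLp.fstL 2 ℝ E ℝ) p :=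
    (WithLp.fstL 2 ℝ E ℝ).hasFDerivAt
  refine (((hasFDerivAt_rotatedReflection_apply m φ p).inner ℝ h3).const_mul
    (1 / 2)).congr_fderiv ?_
  ext X
  have h4 : ⟪rotatedReflection C T (m * p.snd + φ) X.fst, p.fst⟫ =
      ⟪rotatedReflection C T (m * p.snd + φ) p.fst, X.fst⟫ := by
    rw [h.symm, real_inner_comm]
  have h5 : (innerSL ℝ (twistGradient C T m φ p)) X =
      ⟪rotatedReflection C T (m * p.snd + φ) p.fst, X.fst⟫ + twistSlope C T m φ p * X.snd :=
    inner_withLp_prod _ _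
  rw [h5, twistSlope]
  simp only [smul_apply, ContinuousLinearMap.comp_apply,
    ContinuousLinearMap.prod_apply, fderivInnerCLM_apply, add_apply,
    ContinuousLinearMap.smulRight_apply, WithLp.fstL_apply, WithLp.sndL_apply, smul_eq_mul,
    inner_add_left, real_inner_smul_left, h4]
  ring

theorem hasFDerivAt_twistSlope (h : IsCliffordPair C T) (p : WithLp 2 (E × ℝ)) :
    HasFDerivAt (twistSlope C T m φ)
      (m • (innerSL ℝ (rotatedReflection C T (m * p.snd + φ + Real.pi / 2) p.fst) ∘L
          WithLp.fstL 2 ℝ E ℝ) -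
        (m ^ 2 / 2 * ⟪rotatedReflection C T (m * p.snd + φ) p.fst, p.fst⟫) •
          WithLp.sndL 2 ℝ E ℝ) p := by
  -- The slope is m times a twist function a quarter turn ahead, so its gradient is already known.
  have h1 : twistSlope C T m φ = fun q => m * twistFunction C T m (φ + Real.pi / 2) q := by
    ext q
    simp only [twistSlope, twistFunction, add_assoc]
    ring
  rw [h1]
  refine ((h.hasFDerivAt_twistFunction m (φ + Real.pi / 2) p).const_mul m).congr_fderiv ?_
  ext X
  simp only [twistGradient, twistSlope, ← add_assoc, rotatedReflection_half_turn]
  simp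
  ring

theorem hasFDerivAt_twistGradient (h : IsCliffordPair C T) (p : WithLp 2 (E × ℝ)) :
    HasFDerivAt (twistGradient C T m φ) (twistHessian C T m φ p) p :=
  (WithLp.prodContinuousLinearEquiv 2 ℝ E ℝ).symm.toContinuousLinearMap.hasFDerivAt.comp p
    ((hasFDerivAt_rotatedReflection_apply m φ p).prodMk (h.hasFDerivAt_twistSlope m φ p))

variable {m φ}

/-- The diagonal blocks are a traceless reflection and a multiple of the twist function, which is
zero here. Reflecting the height only changes the sign of the second block, so
`trace_reflected_twistHessian` holds for the same reason. -/
theorem trace_twistHessian [FiniteDimensional ℝ E] (h : IsCliffordPair C T)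
    {p : WithLp 2 (E × ℝ)} (hp : twistFunction C T m φ p = 0) :
    LinearMap.trace ℝ _ (twistHessian C T m φ p : _ →ₗ[ℝ] WithLp 2 (E × ℝ)) = 0 := by
  have hp' : ⟪rotatedReflection C T (m * p.snd + φ) p.fst, p.fst⟫ = 0 := by
    simpa [twistFunction] using hp
  rw [trace_withLp_prod _ (rotatedReflection C T (m * p.snd + φ) : E →ₗ[ℝ] E), h.trace_eq_zero]
  · simp [twistHessian_apply_snd, verticalVector, hp']
  · intro v
    simp [twistHessian_apply_fst]

theorem trace_reflected_twistHessian [FiniteDimensional ℝ E] (h : IsCliffordPair C T)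
    {p : WithLp 2 (E × ℝ)} (hp : twistFunction C T m φ p = 0) :
    LinearMap.trace ℝ _ ((heightReflection ∘L twistHessian C T m φ p :
      WithLp 2 (E × ℝ) →L[ℝ] WithLp 2 (E × ℝ)) : _ →ₗ[ℝ] WithLp 2 (E × ℝ)) = 0 := by
  have hp' : ⟪rotatedReflection C T (m * p.snd + φ) p.fst, p.fst⟫ = 0 := by
    simpa [twistFunction] using hp
  rw [trace_withLp_prod _ (rotatedReflection C T (m * p.snd + φ) : E →ₗ[ℝ] E), h.trace_eq_zero]
  · simp [twistHessian_apply_snd, verticalVector, hp']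
  · intro v
    simp [twistHessian_apply_fst]

/-- The plane spanned by the horizontal part of the gradient and by `∂_t` is isotropic for the
Hessian. -/
theorem inner_twistHessian (h : IsCliffordPair C T)
    {p : WithLp 2 (E × ℝ)} (hp : twistFunction C T m φ p = 0) {α β : ℝ} {X : WithLp 2 (E × ℝ)}
    (hX : X = WithLp.toLp 2 (α • rotatedReflection C T (m * p.snd + φ) p.fst, β)) :
    ⟪twistHessian C T m φ p X, X⟫ = 0 := by
  have hp' : ⟪rotatedReflection C T (m * p.snd + φ) p.fst, p.fst⟫ = 0 := by
    simpa [twistFunction] using hp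
  have h2 : ⟪p.fst, rotatedReflection C T (m * p.snd + φ) p.fst⟫ = 0 := by
    rw [← h.symm, hp']
  rw [inner_withLp_prod, twistHessian_apply_fst, twistHessian_apply_snd, hX]
  -- The coefficients of α², αβ and β² are multiples of ⟨x, Ax⟩, ⟨A'x, Ax⟩ and ⟨Ax, x⟩ respectively,
  -- and all three vanish.
  simp only [WithLp.toLp_fst, WithLp.toLp_snd, map_smul, h.sq, inner_add_left,
    real_inner_smul_left, real_inner_smul_right, h.inner_quarter, hp', h2]
  ring

end IsCliffordPair

end Twisting

/-! ### Twisted hypersurfaces over a compatible base: helicoid and isocurvature properties -/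

section TwistedHypersurface

variable {E : Type*} [NormedAddCommGroup E] [InnerProductSpace ℝ E]

/-- The points of `M × ℝ` off the axis where `twistFunction` vanishes. -/
def twistHypersurface (M : Set E) (C T : E →L[ℝ] E) (m φ : ℝ) : Set (WithLp 2 (E × ℝ)) :=
  {p | p.fst ∈ M ∧ p.fst ≠ 0 ∧ twistFunction C T m φ p = 0}

/-- The gradients of the defining functions of `M` are compatible with the twist. -/
def IsTwistCompatible {c : ℕ} (M : Set E) (y : Fin c → E → E) (C T : E →L[ℝ] E) : Prop :=
  ∀ z ∈ M, ∀ φ, ⟪rotatedReflection C T φ z, z⟫ = 0 → ∀ i,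
    ⟪rotatedReflection C T φ z, y i z⟫ = 0 ∧ ⟪rotatedReflection C T φ (y i z), y i z⟫ = 0

/-- Horizontal lift of a family of vector fields. -/
def horizontalLift {c : ℕ} (y : Fin c → E → E) (i : Fin c) (p : WithLp 2 (E × ℝ)) :
    WithLp 2 (E × ℝ) := WithLp.toLp 2 (y i p.fst, 0)

theorem continuous_withLp_fst : Continuous fun p : WithLp 2 (E × ℝ) => p.fst :=
  (WithLp.fstL 2 ℝ E ℝ).continuous

theorem isOpen_fst_ne_zero : IsOpen {p : WithLp 2 (E × ℝ) | p.fst ≠ 0} :=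
  isOpen_ne.preimage continuous_withLp_fst

variable {c : ℕ} {M U : Set E} {h : Fin c → E → ℝ} {y : Fin c → E → E} {C T : E →L[ℝ] E}

theorem IsOrthogonalLevelSet.cylinder (hM : IsOrthogonalLevelSet M U h y) :
    IsOrthogonalLevelSet (cylinder M) {p | p.fst ∈ U} (fun i p => h i p.fst)
      (horizontalLift y) where
  isOpen := hM.isOpen.preimage continuous_withLp_fst
  subset _ hp := hM.subset hp
  contDiffOn i := (hM.contDiffOn i).comp (WithLp.fstL 2 ℝ E ℝ).contDiff.contDiffOn fun _ hp => hp
  mem_iff p hp := hM.mem_iff p.fst hp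
  hasFDerivAt p hp i := by
    refine ((hM.hasFDerivAt p.fst hp i).comp p
      (WithLp.fstL 2 ℝ E ℝ).hasFDerivAt).congr_fderiv ?_
    ext X
    have : (innerSL ℝ (horizontalLift y i p)) X = ⟪y i p.fst, X.fst⟫ + 0 * X.snd :=
      inner_withLp_prod _ _
    rw [this]
    simp
  ne_zero p hp i h0 := hM.ne_zero p.fst hp i (congrArg WithLp.fst h0)
  orthogonal p hp i j hij := by
    rw [inner_withLp_prod]
    simpa [horizontalLift] using hM.orthogonal p.fst hp i j hij

theorem IsOrthogonalLevelSet.horizontalSlice (hM : IsOrthogonalLevelSet M U h y) (t : ℝ) :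
    IsOrthogonalLevelSet (horizontalSlice M t) ({p | p.fst ∈ U} ∩ Set.univ)
      (Fin.cons (fun p => p.snd - t) (fun i p => h i p.fst) :
        Fin (c + 1) → WithLp 2 (E × ℝ) → ℝ)
      (Fin.cons (fun _ => verticalVector) (horizontalLift y) :
        Fin (c + 1) → WithLp 2 (E × ℝ) → WithLp 2 (E × ℝ)) := by
  refine hM.cylinder.cons isOpen_univ (fun q => ?_) ?_ (fun q _ => ?_) (fun q _ h0 => ?_)
    fun q _ i => ?_
  · simp [_root_.horizontalSlice, _root_.cylinder, sub_eq_zero]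
  · exact ((WithLp.sndL 2 ℝ E ℝ).contDiff.sub contDiff_const).contDiffOn
  · refine ((WithLp.sndL 2 ℝ E ℝ).hasFDerivAt.sub_const t).congr_fderiv ?_
    ext X
    have : (innerSL ℝ (verticalVector : WithLp 2 (E × ℝ))) X = ⟪(0 : E), X.fst⟫ + 1 * X.snd :=
      inner_withLp_prod _ _
    rw [this]
    simp
  · exact one_ne_zero (congrArg WithLp.snd h0)
  · rw [inner_withLp_prod]
    simp [verticalVector, horizontalLift]

variable {m φ : ℝ}

theorem inner_rotatedReflection_of_mem {p : WithLp 2 (E × ℝ)}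
    (hp : p ∈ twistHypersurface M C T m φ) :
    ⟪rotatedReflection C T (m * p.snd + φ) p.fst, p.fst⟫ = 0 := by
  simpa [twistFunction] using hp.2.2

/-- The region where the gradient of `twistFunction` is timelike. -/
def steepRegion (C T : E →L[ℝ] E) (m φ : ℝ) : Set (WithLp 2 (E × ℝ)) :=
  {p | ⟪p.fst, p.fst⟫ < twistSlope C T m φ p ^ 2}

theorem isOpen_steepRegion : IsOpen (steepRegion C T m φ) :=
  isOpen_lt (continuous_withLp_fst.inner continuous_withLp_fst)
    ((contDiff_twistSlope m φ).continuous.pow 2)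

namespace IsCliffordPair

theorem twistGradient_ne_zero (hC : IsCliffordPair C T) {p : WithLp 2 (E × ℝ)}
    (hp : p.fst ≠ 0) : twistGradient C T m φ p ≠ 0 := fun h0 =>
  hC.apply_ne_zero (m * p.snd + φ) hp (congrArg WithLp.fst h0)

theorem inner_twistGradient_horizontalLift (hy : IsTwistCompatible M y C T)
    {p : WithLp 2 (E × ℝ)} (hp : p ∈ twistHypersurface M C T m φ) (i : Fin c) :
    ⟪twistGradient C T m φ p, horizontalLift y i p⟫ = 0 := by
  rw [inner_withLp_prod]
  simpa [twistGradient, horizontalLift] using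
    (hy p.fst hp.1 _ (inner_rotatedReflection_of_mem hp) i).1

theorem inner_twistHessian_horizontalLift (hy : IsTwistCompatible M y C T)
    {p : WithLp 2 (E × ℝ)} (hp : p ∈ twistHypersurface M C T m φ) (i : Fin c) :
    ⟪twistHessian C T m φ p (horizontalLift y i p), horizontalLift y i p⟫ = 0 := by
  rw [inner_withLp_prod, twistHessian_apply_fst]
  simpa [horizontalLift] using (hy p.fst hp.1 _ (inner_rotatedReflection_of_mem hp) i).2

theorem isOrthogonalLevelSet (hC : IsCliffordPair C T) (hM : IsOrthogonalLevelSet M U h y)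
    (hy : IsTwistCompatible M y C T) :
    IsOrthogonalLevelSet (twistHypersurface M C T m φ) ({p | p.fst ∈ U} ∩ {p | p.fst ≠ 0})
      (Fin.cons (twistFunction C T m φ) (fun i p => h i p.fst) :
        Fin (c + 1) → WithLp 2 (E × ℝ) → ℝ)
      (Fin.cons (twistGradient C T m φ) (horizontalLift y) :
        Fin (c + 1) → WithLp 2 (E × ℝ) → WithLp 2 (E × ℝ)) :=
  hM.cylinder.cons isOpen_fst_ne_zero (fun _ => Iff.rfl) (contDiff_twistFunction m φ).contDiffOn
    (fun q _ => hC.hasFDerivAt_twistFunction m φ q) (fun _ hq => hC.twistGradient_ne_zero hq.2.1)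
    fun _ hq i => inner_twistGradient_horizontalLift hy hq i

/-- At fixed height the angle is constant, so a section is cut out by the twist function of speed 0.
Its gradient is horizontal, hence orthogonal to ∂_t, and the same Hessian lemmas apply. -/
theorem mem_twistHypersurface_zero_iff {t : ℝ} {q : WithLp 2 (E × ℝ)} (hq : q.snd = t) :
    q ∈ twistHypersurface M C T 0 (m * t + φ) ↔ q ∈ twistHypersurface M C T m φ := by
  simp [twistHypersurface, twistFunction, hq]

theorem isOrthogonalLevelSet_slice (hC : IsCliffordPair C T) (hM : IsOrthogonalLevelSet M U h y)
    (hy : IsTwistCompatible M y C T) (t : ℝ) :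
    IsOrthogonalLevelSet (horizontalSlice M t ∩ twistHypersurface M C T m φ)
      (({p | p.fst ∈ U} ∩ Set.univ) ∩ {p | p.fst ≠ 0})
      (Fin.cons (twistFunction C T 0 (m * t + φ))
        (Fin.cons (fun p => p.snd - t) (fun i p => h i p.fst) :
          Fin (c + 1) → WithLp 2 (E × ℝ) → ℝ) : Fin (c + 1 + 1) → WithLp 2 (E × ℝ) → ℝ)
      (Fin.cons (twistGradient C T 0 (m * t + φ))
        (Fin.cons (fun _ => verticalVector) (horizontalLift y) :
          Fin (c + 1) → WithLp 2 (E × ℝ) → WithLp 2 (E × ℝ)) :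
        Fin (c + 1 + 1) → WithLp 2 (E × ℝ) → WithLp 2 (E × ℝ)) := by
  refine (hM.horizontalSlice t).cons isOpen_fst_ne_zero (fun q => ?_)
    (contDiff_twistFunction 0 (m * t + φ)).contDiffOn
    (fun q _ => hC.hasFDerivAt_twistFunction 0 (m * t + φ) q)
    (fun _ hq => hC.twistGradient_ne_zero hq.2.2.1) fun q hq => ?_
  · constructor
    · rintro ⟨h1, h2⟩
      exact ⟨h1, ((mem_twistHypersurface_zero_iff h1.2).2 h2).2⟩
    · rintro ⟨h1, h2⟩
      exact ⟨h1, (mem_twistHypersurface_zero_iff h1.2).1 ⟨h1.1, h2⟩⟩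
  · rw [Fin.forall_fin_succ]
    refine ⟨?_, fun i => inner_twistGradient_horizontalLift hy
      ((mem_twistHypersurface_zero_iff hq.1.2).2 hq.2) i⟩
    rw [Fin.cons_zero, inner_withLp_prod]
    simp [twistGradient, twistSlope, verticalVector]

variable [FiniteDimensional ℝ E]

theorem isEmbeddedHypersurface (hC : IsCliffordPair C T) (hM : IsOrthogonalLevelSet M U h y)
    (hy : IsTwistCompatible M y C T) (hc : c ≤ Module.finrank ℝ E)
    {W : Set (WithLp 2 (E × ℝ))} (hW : IsOpen W) :
    IsEmbeddedHypersurface (cylinder M) (twistHypersurface M C T m φ ∩ W) := by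
  obtain ⟨d, hd⟩ := Nat.exists_eq_add_of_le hc
  refine ⟨fun p hp => hp.1.1, d, hM.cylinder.isEmbeddedSubmanifold ?_,
    ((hC.isOrthogonalLevelSet hM hy).inter hW).isEmbeddedSubmanifold ?_⟩ <;>
  · rw [finrank_withLp_prod, hd]
    ring

theorem isEmbeddedHypersurface_slice (hC : IsCliffordPair C T) (hM : IsOrthogonalLevelSet M U h y)
    (hy : IsTwistCompatible M y C T) (hc : c + 1 ≤ Module.finrank ℝ E) (t : ℝ) :
    IsEmbeddedHypersurface (horizontalSlice M t)
      (horizontalSlice M t ∩ twistHypersurface M C T m φ) := by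
  obtain ⟨d, hd⟩ := Nat.exists_eq_add_of_le hc
  refine ⟨fun p hp => hp.1, d, (hM.horizontalSlice t).isEmbeddedSubmanifold ?_,
    (hC.isOrthogonalLevelSet_slice hM hy t).isEmbeddedSubmanifold ?_⟩ <;>
  · rw [finrank_withLp_prod, hd]
    ring

theorem isMinimalHypersurface_slice (hC : IsCliffordPair C T) (hM : IsOrthogonalLevelSet M U h y)
    (hy : IsTwistCompatible M y C T) (hc : c + 1 ≤ Module.finrank ℝ E) (t : ℝ) :
    IsMinimalHypersurface (horizontalSlice M t)
      (horizontalSlice M t ∩ twistHypersurface M C T m φ) := by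
  refine ⟨hC.isEmbeddedHypersurface_slice hM hy hc t, fun W hW N hN p hp => ?_⟩
  have hp0 : p ∈ twistHypersurface M C T 0 (m * t + φ) :=
    (mem_twistHypersurface_zero_iff hp.1.1.2).2 hp.1.2
  refine hN.meanCurvature_eq_zero (hM.horizontalSlice t) (fun q hq => hq.1.1)
    ((hC.isOrthogonalLevelSet_slice hM hy t).inter hW) hp
    (hC.hasFDerivAt_twistGradient 0 (m * t + φ) p) (hC.trace_twistHessian hp0.2.2)
    (hC.inner_twistHessian hp0.2.2 (α := 1) (by rw [one_smul]; rfl)) ?_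
  rw [Fin.forall_fin_succ]
  refine ⟨hC.inner_twistHessian hp0.2.2 (α := 0) (β := 1) (by simp [verticalVector]),
    inner_twistHessian_horizontalLift hy hp0⟩

theorem isUnitNormalField (hC : IsCliffordPair C T) (hM : IsOrthogonalLevelSet M U h y)
    (hy : IsTwistCompatible M y C T) {W : Set (WithLp 2 (E × ℝ))} (hW : IsOpen W) :
    IsUnitNormalField (cylinder M) (twistHypersurface M C T m φ ∩ W)
      fun p => ‖twistGradient C T m φ p‖⁻¹ • twistGradient C T m φ p := by
  refine ⟨⟨⟨{p | p.fst ≠ 0}, isOpen_fst_ne_zero, fun p hp => hp.1.2.1, ?_⟩, fun p hp => ?_⟩,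
    fun p hp => ⟨?_, fun X hX => ?_⟩⟩
  · intro p hp
    have h1 : ContDiffAt ℝ ∞ (twistGradient C T m φ) p := (contDiff_twistGradient m φ).contDiffAt
    have h0 : twistGradient C T m φ p ≠ 0 := hC.twistGradient_ne_zero hp
    exact (((h1.norm ℝ h0).inv (norm_ne_zero_iff.2 h0)).smul h1).contDiffWithinAt
  · refine (hM.cylinder.mem_tangentSpaceAt_iff hp.1.1).2 fun i => ?_
    rw [real_inner_smul_right, real_inner_comm, inner_twistGradient_horizontalLift hy hp.1,
      mul_zero]
  · have h0 : twistGradient C T m φ p ≠ 0 := hC.twistGradient_ne_zero hp.1.2.1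
    rw [norm_smul, norm_inv, norm_norm, inv_mul_cancel₀ (norm_ne_zero_iff.2 h0)]
  · rw [real_inner_smul_right, real_inner_comm,
      ((((hC.isOrthogonalLevelSet hM hy).inter hW).mem_tangentSpaceAt_cons_iff hp).1 hX).1,
      mul_zero]

theorem heightGradient_eq (hC : IsCliffordPair C T) (hM : IsOrthogonalLevelSet M U h y)
    (hy : IsTwistCompatible M y C T) {p : WithLp 2 (E × ℝ)}
    (hp : p ∈ twistHypersurface M C T m φ) :
    (heightGradient (twistHypersurface M C T m φ) p : WithLp 2 (E × ℝ)) =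
      verticalVector - (twistSlope C T m φ p /
        ⟪twistGradient C T m φ p, twistGradient C T m φ p⟫) • twistGradient C T m φ p := by
  have h1 := (hC.isOrthogonalLevelSet hM hy).starProjection_eq hp verticalVector
  rw [Fin.sum_univ_succ] at h1
  have h2 : ∀ i, ⟪horizontalLift y i p, (verticalVector : WithLp 2 (E × ℝ))⟫ = 0 := fun i => by
    rw [inner_withLp_prod]
    simp [horizontalLift, verticalVector]
  have h3 : ⟪twistGradient C T m φ p, (verticalVector : WithLp 2 (E × ℝ))⟫ =
      twistSlope C T m φ p := by
    rw [inner_withLp_prod]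
    simp [twistGradient, verticalVector]
  simp only [Fin.cons_zero, Fin.cons_succ, h2, h3, zero_div, zero_smul, Finset.sum_const_zero,
    add_zero] at h1
  exact h1

/-- Otherwise ∂_t would be a multiple of the gradient, whose horizontal part A x is nonzero. This is
where removing the axis x = 0 matters. -/
theorem heightGradient_ne_zero (hC : IsCliffordPair C T) (hM : IsOrthogonalLevelSet M U h y)
    (hy : IsTwistCompatible M y C T) {p : WithLp 2 (E × ℝ)}
    (hp : p ∈ twistHypersurface M C T m φ) :
    heightGradient (twistHypersurface M C T m φ) p ≠ 0 := by
  intro h0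
  have h1 := congrArg (Subtype.val) h0
  rw [hC.heightGradient_eq hM hy hp, ZeroMemClass.coe_zero, sub_eq_zero] at h1
  have hf := congrArg WithLp.fst h1
  have hs := congrArg WithLp.snd h1
  have hA := hC.apply_ne_zero (m * p.snd + φ) hp.2.1
  simp only [verticalVector, twistGradient, WithLp.smul_fst, WithLp.smul_snd, WithLp.toLp_fst,
    WithLp.toLp_snd] at hf hs
  rcases smul_eq_zero.1 hf.symm with h2 | h2
  · rw [h2] at hs
    simp at hs
  · exact hA h2

theorem asymptotic (hC : IsCliffordPair C T) (hM : IsOrthogonalLevelSet M U h y)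
    (hy : IsTwistCompatible M y C T) {N : WithLp 2 (E × ℝ) → WithLp 2 (E × ℝ)}
    (hN : IsUnitNormalField (cylinder M) (twistHypersurface M C T m φ) N) {p : WithLp 2 (E × ℝ)}
    (hp : p ∈ twistHypersurface M C T m φ) :
    ⟪shapeOperator (cylinder M) (twistHypersurface M C T m φ) N p
      (heightGradient (twistHypersurface M C T m φ) p),
      heightGradient (twistHypersurface M C T m φ) p⟫ = 0 := by
  have hS := hC.isOrthogonalLevelSet (m := m) (φ := φ) hM hy
  have hSP : twistHypersurface M C T m φ ⊆ cylinder M := fun q hq => hq.1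
  rw [inner_shapeOperator (hM.cylinder.tangentSpaceAt_le hSP hS hp),
    hN.inner_fderiv hM.cylinder hSP hS hp (hC.hasFDerivAt_twistGradient m φ p)
      (Subtype.prop _) (Subtype.prop _), hC.heightGradient_eq hM hy hp]
  set r := twistSlope C T m φ p / ⟪twistGradient C T m φ p, twistGradient C T m φ p⟫
  -- ∂_t minus r times the gradient lies in the isotropic plane, with these coordinates.
  rw [hC.inner_twistHessian hp.2.2 (α := -r) (β := 1 - r * twistSlope C T m φ p), mul_zero,
    neg_zero]
  exact withLp_prod_ext (by simp [verticalVector, twistGradient])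
    (by simp [verticalVector, twistGradient])

/-- Any unit normal is a nonzero multiple of the gradient. Comparing zeros is enough for
nonconstancy and avoids choosing a sign of N. -/
theorem angleFunction_eq_zero_iff (hC : IsCliffordPair C T) (hM : IsOrthogonalLevelSet M U h y)
    (hy : IsTwistCompatible M y C T) {N : WithLp 2 (E × ℝ) → WithLp 2 (E × ℝ)}
    (hN : IsUnitNormalField (cylinder M) (twistHypersurface M C T m φ) N) {p : WithLp 2 (E × ℝ)}
    (hp : p ∈ twistHypersurface M C T m φ) :
    angleFunction N p = 0 ↔ twistSlope C T m φ p = 0 := by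
  have h1 := hN.eq_smul hM.cylinder (fun q hq => hq.1) (hC.isOrthogonalLevelSet hM hy) hp
  have h3 : ⟪twistGradient C T m φ p, (verticalVector : WithLp 2 (E × ℝ))⟫ =
      twistSlope C T m φ p := by
    rw [inner_withLp_prod]
    simp [twistGradient, verticalVector]
  have h4 : ⟪twistGradient C T m φ p, N p⟫ /
      ⟪twistGradient C T m φ p, twistGradient C T m φ p⟫ ≠ 0 := fun h0 => by
    rw [h0, zero_smul] at h1
    simpa [h1] using (hN.2 p hp).1
  rw [angleFunction, h1, real_inner_smul_left, h3, mul_eq_zero, or_iff_right h4]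

/-- A twisted hypersurface is a vertical helicoid. -/
theorem isVerticalHelicoid (hC : IsCliffordPair C T) (hM : IsOrthogonalLevelSet M U h y)
    (hy : IsTwistCompatible M y C T) (hc : c + 1 ≤ Module.finrank ℝ E)
    (h0 : ∃ p ∈ twistHypersurface M C T m φ, twistSlope C T m φ p = 0)
    (h1 : ∃ p ∈ twistHypersurface M C T m φ, twistSlope C T m φ p ≠ 0) :
    IsVerticalHelicoid M (twistHypersurface M C T m φ) where
  hypersurface := by
    simpa using hC.isEmbeddedHypersurface hM hy (Nat.le_of_succ_le hc) isOpen_univ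
  orientable := ⟨_, by simpa using hC.isUnitNormalField hM hy isOpen_univ⟩
  no_horizontal_point _ hp := hC.heightGradient_ne_zero hM hy hp
  angle_nonconstant N hN := by
    obtain ⟨p, hp, hp0⟩ := h0
    obtain ⟨q, hq, hq0⟩ := h1
    refine ⟨p, hp, q, hq, fun hpq => hq0 ?_⟩
    rw [← hC.angleFunction_eq_zero_iff hM hy hN hq, ← hpq,
      hC.angleFunction_eq_zero_iff hM hy hN hp, hp0]
  sections_minimal t := hC.isMinimalHypersurface_slice hM hy hc t
  asymptotic _ hN _ hp := hC.asymptotic hM hy hN hp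

theorem isSpacelike (hC : IsCliffordPair C T) (hM : IsOrthogonalLevelSet M U h y)
    (hy : IsTwistCompatible M y C T) :
    IsSpacelike (twistHypersurface M C T m φ ∩ steepRegion C T m φ) := by
  intro p hp X hX hX0
  have h1 := ((((hC.isOrthogonalLevelSet hM hy).inter
    isOpen_steepRegion).mem_tangentSpaceAt_cons_iff hp).1 hX).1
  rw [inner_withLp_prod] at h1
  simp only [twistGradient, WithLp.toLp_fst, WithLp.toLp_snd] at h1
  -- Tangency gives ⟨Ax, X.fst⟩ = -σ X.snd. Cauchy–Schwarz with |Ax| = |x| then yields σ² X.snd² ≤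
  -- |x|² |X.fst|², and |x|² < σ² makes X spacelike.
  have h2 := real_inner_mul_inner_self_le (rotatedReflection C T (m * p.snd + φ) p.fst) X.fst
  rw [hC.inner_self] at h2
  have h3 : ⟪p.fst, p.fst⟫ < twistSlope C T m φ p ^ 2 := hp.2
  have h4 : 0 < ⟪p.fst, p.fst⟫ := real_inner_self_pos.2 hp.1.2.1
  have h5 : ⟪rotatedReflection C T (m * p.snd + φ) p.fst, X.fst⟫ =
    -(twistSlope C T m φ p * X.snd) := by linarith
  rw [h5] at h2
  rw [lorentzForm]
  by_cases hs : X.snd = 0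
  · have hf : X.fst ≠ 0 := fun hf => hX0 (withLp_prod_ext hf hs)
    rw [hs, mul_zero, sub_zero]
    exact real_inner_self_pos.2 hf
  · have h6 : 0 < X.snd ^ 2 := by positivity
    nlinarith

/-- Reflecting a Euclidean normal in the height gives a Lorentzian normal. Its Lorentzian square is
|x|² - σ², negative on the steep region. -/
theorem isLorentzUnitNormalField (hC : IsCliffordPair C T) (hM : IsOrthogonalLevelSet M U h y)
    (hy : IsTwistCompatible M y C T) :
    IsLorentzUnitNormalField M (twistHypersurface M C T m φ ∩ steepRegion C T m φ)
      fun p => (√(twistSlope C T m φ p ^ 2 - ⟪p.fst, p.fst⟫))⁻¹ •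
        heightReflection (twistGradient C T m φ p) := by
  refine ⟨⟨⟨steepRegion C T m φ, isOpen_steepRegion, fun p hp => hp.2, ?_⟩, fun p hp => ?_⟩,
    fun p hp => ⟨?_, fun X hX => ?_⟩⟩
  · intro p hp
    have hpos : 0 < twistSlope C T m φ p ^ 2 - ⟪p.fst, p.fst⟫ := sub_pos.2 hp
    have h1 : ContDiffAt ℝ ∞ (fun q : WithLp 2 (E × ℝ) =>
        twistSlope C T m φ q ^ 2 - ⟪q.fst, q.fst⟫) p :=
      (((contDiff_twistSlope m φ).pow 2).sub ((WithLp.fstL 2 ℝ E ℝ).contDiff.inner ℝ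
        (WithLp.fstL 2 ℝ E ℝ).contDiff)).contDiffAt
    exact (((h1.sqrt hpos.ne').inv (Real.sqrt_ne_zero'.2 hpos)).smul
      (heightReflection.contDiff.comp (contDiff_twistGradient m φ)).contDiffAt).contDiffWithinAt
  · refine (hM.cylinder.mem_tangentSpaceAt_iff hp.1.1).2 fun i => ?_
    have h1 := inner_twistGradient_horizontalLift hy hp.1 i
    rw [real_inner_comm, inner_withLp_prod] at h1
    rw [real_inner_smul_right, inner_withLp_prod]
    simp only [horizontalLift, WithLp.toLp_snd, zero_mul, add_zero, heightReflection_fst] at h1 ⊢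
    rw [h1, mul_zero]
  · have hpos : 0 < twistSlope C T m φ p ^ 2 - ⟪p.fst, p.fst⟫ := sub_pos.2 hp.2
    have hsq := Real.sq_sqrt hpos.le
    have h0 := Real.sqrt_ne_zero'.2 hpos
    have h1 : ⟪heightReflection (twistGradient C T m φ p), twistGradient C T m φ p⟫ =
        -(√(twistSlope C T m φ p ^ 2 - ⟪p.fst, p.fst⟫)) ^ 2 := by
      rw [hsq, inner_withLp_prod]
      simp only [heightReflection_fst, heightReflection_snd, twistGradient, WithLp.toLp_fst,
        WithLp.toLp_snd, hC.inner_self]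
      ring
    rw [lorentzForm_eq_inner, map_smul, heightReflection_heightReflection, real_inner_smul_left, real_inner_smul_right, h1]
    field_simp
  · rw [lorentzForm_eq_inner, map_smul, heightReflection_heightReflection, real_inner_smul_right,
      real_inner_comm _ X,
      ((((hC.isOrthogonalLevelSet hM hy).inter
        isOpen_steepRegion).mem_tangentSpaceAt_cons_iff hp).1 hX).1, mul_zero]

/-- The steep part of a twisted hypersurface is spacelike and zero mean isocurved. -/
theorem isZeroMeanIsocurved (hC : IsCliffordPair C T) (hM : IsOrthogonalLevelSet M U h y)
    (hy : IsTwistCompatible M y C T) (hc : c ≤ Module.finrank ℝ E) :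
    IsZeroMeanIsocurved M (twistHypersurface M C T m φ ∩ steepRegion C T m φ) where
  hypersurface := hC.isEmbeddedHypersurface hM hy hc isOpen_steepRegion
  spacelike := hC.isSpacelike hM hy
  orientable := ⟨_, hC.isUnitNormalField hM hy isOpen_steepRegion⟩
  lorentz_orientable := ⟨_, hC.isLorentzUnitNormalField hM hy⟩
  meanCurvature_eq_zero N hN p hp := hN.meanCurvature_eq_zero hM.cylinder (fun q hq => hq.1.1)
    ((hC.isOrthogonalLevelSet hM hy).inter isOpen_steepRegion) hp
    (hC.hasFDerivAt_twistGradient m φ p) (hC.trace_twistHessian hp.1.2.2)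
    (hC.inner_twistHessian hp.1.2.2 (α := 1) (by rw [one_smul]; rfl))
    (inner_twistHessian_horizontalLift hy hp.1)
  lorentzMeanCurvature_eq_zero N hN p hp := by
    rw [lorentzMeanCurvature, trace_shapeOperator_indefinite (R := heightReflection) ?_ ?_ hN.1
      hM.cylinder (fun q hq => hq.1.1) ((hC.isOrthogonalLevelSet hM hy).inter isOpen_steepRegion)
      ?_ ?_ ?_ hp (hC.hasFDerivAt_twistGradient m φ p)
      (hC.trace_reflected_twistHessian hp.1.2.2) ?_ (inner_twistHessian_horizontalLift hy hp.1),
      neg_zero]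
    · intro X Y
      simp
    · exact heightReflection_heightReflection
    · intro q _ i
      exact withLp_prod_ext rfl neg_zero
    · intro q hq
      rw [← lorentzForm_eq_inner]
      exact (hN.2 q hq).1
    · intro q hq X hX
      rw [← lorentzForm_eq_inner]
      exact (hN.2 q hq).2 X hX
    -- The reflected gradient stays in the isotropic plane.
    · refine hC.inner_twistHessian hp.1.2.2 (α := 1) (β := -twistSlope C T m φ p) ?_
      exact withLp_prod_ext (by simp [twistGradient]) rfl

end IsCliffordPair

end TwistedHypersurface

/-! ### The rotation group and the implicit equation of a twisting -/

section Rotation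

variable {E : Type*} [NormedAddCommGroup E] [InnerProductSpace ℝ E] {C T : E →L[ℝ] E}

/-- The rotation generated by the complex structure `T ∘ C`. -/
noncomputable def cliffordRotation (C T : E →L[ℝ] E) (θ : ℝ) (x : E) : E :=
  Real.cos θ • x + Real.sin θ • T (C x)

namespace IsCliffordPair

theorem inner_cliffordRotation (h : IsCliffordPair C T) (θ : ℝ) (x y : E) :
    ⟪cliffordRotation C T θ x, cliffordRotation C T θ y⟫ = ⟪x, y⟫ := by
  have h1 : ⟪T (C x), T (C y)⟫ = ⟪x, y⟫ := by
    rw [h.symm_right, h.sq_right, h.symm_left, h.sq_left]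
  have h2 : ⟪T (C x), y⟫ = -⟪x, T (C y)⟫ := by
    rw [h.symm_right, h.symm_left, h.anticomm, inner_neg_right]
  simp only [cliffordRotation, inner_add_left, inner_add_right, real_inner_smul_left,
    real_inner_smul_right, h1, h2]
  linear_combination ⟪x, y⟫ * Real.cos_sq_add_sin_sq θ

theorem cliffordRotation_neg_apply (h : IsCliffordPair C T) (θ : ℝ) (x : E) :
    cliffordRotation C T θ (cliffordRotation C T (-θ) x) = x := by
  have hx : (Real.cos θ ^ 2 + Real.sin θ ^ 2) • x = x := by
    rw [Real.cos_sq_add_sin_sq, one_smul]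
  simp only [cliffordRotation, map_add, map_smul, h.anticomm, map_neg, h.sq_left, h.sq_right,
    Real.cos_neg, Real.sin_neg]
  conv_rhs => rw [← hx]
  module

/-- T ∘ C anticommutes with C, so conjugating C by the rotation through θ multiplies it by the
rotation through 2θ. This doubling is the factor 2 in the speed 2k/a. -/
theorem rotatedReflection_cliffordRotation (h : IsCliffordPair C T) (θ : ℝ) (x : E) :
    rotatedReflection C T (2 * θ) (cliffordRotation C T θ x) = cliffordRotation C T θ (C x) := by
  have hc : Real.cos θ = Real.cos (2 * θ) * Real.cos θ + Real.sin (2 * θ) * Real.sin θ := by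
    rw [← Real.cos_sub]
    ring_nf
  have hs : Real.sin θ = Real.sin (2 * θ) * Real.cos θ - Real.cos (2 * θ) * Real.sin θ := by
    rw [← Real.sin_sub]
    ring_nf
  have h1 : cliffordRotation C T θ (C x) =
      (Real.cos (2 * θ) * Real.cos θ + Real.sin (2 * θ) * Real.sin θ) • C x +
      (Real.sin (2 * θ) * Real.cos θ - Real.cos (2 * θ) * Real.sin θ) • T x := by
    rw [← hc, ← hs, cliffordRotation, h.sq_left]
  rw [h1]
  simp only [rotatedReflection_apply, cliffordRotation, map_add, map_smul, h.anticomm, h.sq_left,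
    h.sq_right]
  module

/-- The twisting of an invariantly described set by the rotation is a `twistHypersurface`. -/
theorem pitchedTwisting_eq (h : IsCliffordPair C T) {a k : ℝ} (ha : 0 < a) {M S₀ : Set E}
    (hM : ∀ θ x, cliffordRotation C T θ x ∈ M ↔ x ∈ M)
    (hS₀ : ∀ x, x ∈ S₀ ↔ x ∈ M ∧ x ≠ 0 ∧ ⟪C x, x⟫ = 0) :
    pitchedTwisting a (fun s => cliffordRotation C T (k * s)) S₀ =
      twistHypersurface M C T (2 * k / a) 0 := by
  have hne : ∀ θ x, cliffordRotation C T θ x ≠ 0 ↔ x ≠ 0 := fun θ x => by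
    rw [← inner_self_ne_zero (𝕜 := ℝ), h.inner_cliffordRotation, inner_self_ne_zero]
  have key : ∀ (p : E) (s : ℝ), WithLp.toLp 2 (cliffordRotation C T (k * s) p, a * s) ∈
      twistHypersurface M C T (2 * k / a) 0 ↔ p ∈ S₀ := by
    intro p s
    have e : 2 * k / a * (a * s) + 0 = 2 * (k * s) := by
      field_simp
      ring
    rw [hS₀]
    simp only [twistHypersurface, Set.mem_ofPred_eq, twistFunction, WithLp.toLp_fst,
      WithLp.toLp_snd, e, h.rotatedReflection_cliffordRotation, h.inner_cliffordRotation, hM, hne]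
    simp
  ext x
  constructor
  · rintro ⟨p, hp, s, rfl⟩
    exact (key p s).2 hp
  · intro hx
    -- The height determines s = t / a; undoing the rotation for that s recovers the base point.
    have e : x = WithLp.toLp 2 (cliffordRotation C T (k * (x.snd / a))
        (cliffordRotation C T (-(k * (x.snd / a))) x.fst), a * (x.snd / a)) := by
      rw [h.cliffordRotation_neg_apply]
      exact withLp_prod_ext rfl (mul_div_cancel₀ _ ha.ne').symm
    refine ⟨_, ?_, _, e⟩
    rw [e] at hx
    exact (key _ _).1 hx

end IsCliffordPair

end Rotation

/-! ### The two base manifolds as level sets -/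

section LevelSetsOfE

variable {E : Type*} [NormedAddCommGroup E] [InnerProductSpace ℝ E]

theorem isOrthogonalLevelSet_univ :
    IsOrthogonalLevelSet (Set.univ : Set E) Set.univ (Fin.elim0 : Fin 0 → E → ℝ)
      (Fin.elim0 : Fin 0 → E → E) where
  isOpen := isOpen_univ
  subset := subset_rfl
  contDiffOn i := i.elim0
  mem_iff _ _ := ⟨fun _ i => i.elim0, fun _ => trivial⟩
  hasFDerivAt _ _ i := i.elim0
  ne_zero _ _ i := i.elim0
  orthogonal _ _ i := i.elim0

theorem mem_unit_sphere_iff_inner (x : E) : x ∈ Metric.sphere (0 : E) 1 ↔ ⟪x, x⟫ = 1 := by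
  rw [mem_sphere_zero_iff_norm, real_inner_self_eq_norm_sq]
  constructor
  · intro h
    rw [h, one_pow]
  · intro h
    exact (pow_eq_one_iff_of_nonneg (norm_nonneg x) two_ne_zero).1 h

/-- The factor 1/2 makes the gradient at x equal to x, so that compatibility with the twist reduces
to ⟨Ax, x⟩ = 0. -/
theorem isOrthogonalLevelSet_sphere :
    IsOrthogonalLevelSet (Metric.sphere (0 : E) 1) Set.univ
      (fun (_ : Fin 1) (x : E) => 1 / 2 * ⟪x, x⟫ - 1 / 2) (fun (_ : Fin 1) (x : E) => x) where
  isOpen := isOpen_univ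
  subset := Set.subset_univ _
  contDiffOn _ := ((contDiff_const.mul (contDiff_id.inner ℝ contDiff_id)).sub
    contDiff_const).contDiffOn
  mem_iff x _ := by
    rw [mem_unit_sphere_iff_inner]
    constructor
    · intro h _
      rw [h]
      ring
    · intro h
      linarith [h 0]
  hasFDerivAt x _ _ := by
    refine ((((hasFDerivAt_id x).inner ℝ (hasFDerivAt_id x)).const_mul (1 / 2)).sub_const
      (1 / 2)).congr_fderiv ?_
    ext v
    simp [fderivInnerCLM_apply, real_inner_comm]
    ring
  ne_zero x hx _ := ne_zero_of_mem_unit_sphere (⟨x, hx⟩ : Metric.sphere (0 : E) 1)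
  orthogonal _ _ i j hij := absurd (Subsingleton.elim i j) hij

end LevelSetsOfE

/-! ### The Clifford torus, its cone, and explicit points on it -/

section CliffordTorus

variable {n : ℕ}

/-- The reflection `(x, y) ↦ (x, -y)` of `ℝ^{n+1} × ℝ^{n+1}`. -/
noncomputable def blockConj (n : ℕ) : DoubleSpace n →L[ℝ] DoubleSpace n :=
  LinearMap.toContinuousLinearMap
    { toFun := fun p => WithLp.toLp 2 (Sum.elim (fun i => p (Sum.inl i)) fun i => -p (Sum.inr i))
      map_add' := fun p q => by
        ext (i | i) <;> simp [add_comm]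
      map_smul' := fun r p => by
        ext (i | i) <;> simp }

/-- The reflection `(x, y) ↦ (y, x)` of `ℝ^{n+1} × ℝ^{n+1}`. -/
noncomputable def blockSwap (n : ℕ) : DoubleSpace n →L[ℝ] DoubleSpace n :=
  LinearMap.toContinuousLinearMap
    { toFun := fun p => WithLp.toLp 2 (Sum.elim (fun i => p (Sum.inr i)) fun i => p (Sum.inl i))
      map_add' := fun p q => by
        ext (i | i) <;> simp
      map_smul' := fun r p => by
        ext (i | i) <;> simp }

@[simp] theorem blockConj_inl (p : DoubleSpace n) (i : Fin (n + 1)) :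
    blockConj n p (Sum.inl i) = p (Sum.inl i) := rfl

@[simp] theorem blockConj_inr (p : DoubleSpace n) (i : Fin (n + 1)) :
    blockConj n p (Sum.inr i) = -p (Sum.inr i) := rfl

@[simp] theorem blockSwap_inl (p : DoubleSpace n) (i : Fin (n + 1)) :
    blockSwap n p (Sum.inl i) = p (Sum.inr i) := rfl

@[simp] theorem blockSwap_inr (p : DoubleSpace n) (i : Fin (n + 1)) :
    blockSwap n p (Sum.inr i) = p (Sum.inl i) := rfl

theorem inner_doubleSpace (p q : DoubleSpace n) :
    ⟪p, q⟫ = ∑ i, p (Sum.inl i) * q (Sum.inl i) + ∑ i, p (Sum.inr i) * q (Sum.inr i) := by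
  rw [PiLp.inner_apply, Fintype.sum_sum_type]
  simp [mul_comm]

theorem isCliffordPair_block : IsCliffordPair (blockConj n) (blockSwap n) where
  symm_left p q := by simp [inner_doubleSpace]
  symm_right p q := by simp [inner_doubleSpace, add_comm]
  sq_left p := by ext (i | i) <;> simp
  sq_right p := by ext (i | i) <;> simp
  anticomm p := by ext (i | i) <;> simp

/-- As J² = -1, there is an algebra map from ℂ sending i to J. It is continuous, so it commutes with
the exponential series and transports Euler's formula. -/
theorem exp_smul_J (θ : ℝ) :
    NormedSpace.exp (θ • Matrix.J (Fin (n + 1)) ℝ) =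
      Real.cos θ • (1 : Matrix (Fin (n + 1) ⊕ Fin (n + 1)) (Fin (n + 1) ⊕ Fin (n + 1)) ℝ) +
        Real.sin θ • Matrix.J (Fin (n + 1)) ℝ := by
  let ψ : ℂ →ₐ[ℝ] Matrix (Fin (n + 1) ⊕ Fin (n + 1)) (Fin (n + 1) ⊕ Fin (n + 1)) ℝ :=
    Complex.liftAux (Matrix.J (Fin (n + 1)) ℝ) (Matrix.J_squared _ _)
  have hψ : Continuous ψ := ψ.toLinearMap.continuous_of_finiteDimensional
  have h1 : θ • Matrix.J (Fin (n + 1)) ℝ = ψ (θ * Complex.I) := by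
    simp [ψ, Complex.liftAux_apply]
  have h2 : NormedSpace.exp (ψ (θ * Complex.I)) = ψ (NormedSpace.exp (θ * Complex.I)) := by
    rw [NormedSpace.exp_eq_tsum ℝ, NormedSpace.exp_eq_tsum ℝ]
    refine Eq.trans ?_ ((NormedSpace.expSeries_summable' (𝕂 := ℝ)
      (θ * Complex.I)).hasSum.map ψ hψ).tsum_eq
    simp only [Function.comp_def, map_smul, map_pow]
  rw [h1, h2, ← Complex.exp_eq_exp_ℂ, Complex.exp_mul_I]
  simp [ψ, Complex.liftAux_apply, Algebra.algebraMap_eq_smul_one, ← Complex.ofReal_cos,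
    ← Complex.ofReal_sin]

theorem rotationGroup_eq (k s : ℝ) :
    rotationGroup n k s = cliffordRotation (blockConj n) (blockSwap n) (k * s) := by
  ext p (i | i) <;>
  simp only [rotationGroup, exp_smul_J, cliffordRotation] <;>
  simp [Matrix.toLpLin_apply, Matrix.J, Matrix.fromBlocks_mulVec, Matrix.neg_mulVec]

/-- |x|² = |y|² = 1/2 is equivalent to |x|² + |y|² = 1 together with |x|² - |y|² = 0; the
nonvanishing condition is automatic on the sphere. -/
theorem mem_cliffordTorus_iff (p : DoubleSpace n) :
    p ∈ cliffordTorus n ↔ p ∈ oddSphere n ∧ p ≠ 0 ∧ ⟪blockConj n p, p⟫ = 0 := by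
  have key : ∀ x : Fin (n + 1) → ℝ, (WithLp.toLp 2 x : EuclideanSpace ℝ (Fin (n + 1))) ∈
      Metric.sphere 0 (1 / √2) ↔ ∑ i, x i * x i = 1 / 2 := by
    intro x
    rw [mem_sphere_zero_iff_norm, ← sq_eq_sq₀ (norm_nonneg _) (by positivity),
      EuclideanSpace.norm_sq_eq, div_pow, Real.sq_sqrt (by norm_num)]
    simp [sq]
  have h0 : p ∈ oddSphere n → p ≠ 0 := fun hp =>
    ne_zero_of_mem_unit_sphere (⟨p, hp⟩ : Metric.sphere (0 : DoubleSpace n) 1)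
  have h1 : p ∈ oddSphere n ∧ p ≠ 0 ∧ ⟪blockConj n p, p⟫ = 0 ↔
      p ∈ oddSphere n ∧ ⟪blockConj n p, p⟫ = 0 :=
    ⟨fun h => ⟨h.1, h.2.2⟩, fun h => ⟨h.1, h0 h.1, h.2⟩⟩
  rw [h1, oddSphere, mem_unit_sphere_iff_inner, cliffordTorus, Set.mem_ofPred_eq, key, key,
    inner_doubleSpace, inner_doubleSpace]
  simp only [blockConj_inl, blockConj_inr, neg_mul, Finset.sum_neg_distrib]
  constructor
  · rintro ⟨h2, h3⟩
    constructor <;> linarith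
  · rintro ⟨h2, h3⟩
    constructor <;> linarith

/-- The quadratic equation is homogeneous, so passing to the cone drops the sphere equation and
keeps only p ≠ 0. -/
theorem mem_coneOver_cliffordTorus_iff (p : DoubleSpace n) :
    p ∈ coneOver (cliffordTorus n) ↔ p ∈ Set.univ ∧ p ≠ 0 ∧ ⟪blockConj n p, p⟫ = 0 := by
  constructor
  · rintro ⟨r, hr, q, hq, rfl⟩
    obtain ⟨-, h1, h2⟩ := (mem_cliffordTorus_iff q).1 hq
    refine ⟨trivial, smul_ne_zero hr.ne' h1, ?_⟩
    rw [map_smul, real_inner_smul_left, real_inner_smul_right, h2, mul_zero, mul_zero]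
  · rintro ⟨-, h1, h2⟩
    have h3 : ‖p‖ ≠ 0 := norm_ne_zero_iff.2 h1
    refine ⟨‖p‖, norm_pos_iff.2 h1, ‖p‖⁻¹ • p, (mem_cliffordTorus_iff _).2
      ⟨?_, smul_ne_zero (inv_ne_zero h3) h1, ?_⟩, by rw [smul_smul, mul_inv_cancel₀ h3, one_smul]⟩
    · rw [oddSphere, mem_sphere_zero_iff_norm, norm_smul, norm_inv, norm_norm, inv_mul_cancel₀ h3]
    · rw [map_smul, real_inner_smul_left, real_inner_smul_right, h2, mul_zero, mul_zero]

theorem twistedCliffordTorus_eq {a k : ℝ} (ha : 0 < a) : twistedCliffordTorus n a k =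
    twistHypersurface (oddSphere n) (blockConj n) (blockSwap n) (2 * k / a) 0 := by
  rw [twistedCliffordTorus, ← isCliffordPair_block.pitchedTwisting_eq ha (fun θ x => ?_)
    mem_cliffordTorus_iff, funext (rotationGroup_eq k)]
  rw [oddSphere, mem_unit_sphere_iff_inner, mem_unit_sphere_iff_inner,
    isCliffordPair_block.inner_cliffordRotation]

theorem twistedCliffordCone_eq {a k : ℝ} (ha : 0 < a) : twistedCliffordCone n a k =
    twistHypersurface Set.univ (blockConj n) (blockSwap n) (2 * k / a) 0 := by
  rw [twistedCliffordCone, ← isCliffordPair_block.pitchedTwisting_eq ha (fun θ x => Iff.rfl)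
    mem_coneOver_cliffordTorus_iff, funext (rotationGroup_eq k)]

/-- The point of the Clifford torus at height `0` with components `e_0 / √2` and `e_j / √2`. -/
noncomputable def torusPoint (j : Fin (n + 1)) : WithLp 2 (DoubleSpace n × ℝ) :=
  WithLp.toLp 2 (WithLp.toLp 2 (Sum.elim (Pi.single 0 (1 / √2)) (Pi.single j (1 / √2))), 0)

theorem torusPoint_mem (m : ℝ) (j : Fin (n + 1)) : torusPoint j ∈
    twistHypersurface (oddSphere n) (blockConj n) (blockSwap n) m 0 := by
  have h : (√2)⁻¹ * (√2)⁻¹ = (2 : ℝ)⁻¹ := by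
    rw [← mul_inv, Real.mul_self_sqrt (by norm_num)]
  have h1 : (torusPoint j).fst ∈ cliffordTorus n := by
    rw [mem_cliffordTorus_iff]
    have h2 : (torusPoint j).fst ∈ oddSphere n := by
      rw [oddSphere, mem_unit_sphere_iff_inner, inner_doubleSpace]
      simp [torusPoint, Pi.single_apply, h]
      norm_num
    refine ⟨h2, ne_zero_of_mem_unit_sphere (⟨_, h2⟩ : Metric.sphere (0 : DoubleSpace n) 1), ?_⟩
    rw [inner_doubleSpace]
    simp [torusPoint, Pi.single_apply]
  obtain ⟨h2, h3, h4⟩ := (mem_cliffordTorus_iff _).1 h1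
  refine ⟨h2, h3, ?_⟩
  have h5 : (torusPoint j).snd = 0 := rfl
  simp [twistFunction, rotatedReflection_apply, h4, h5]

/-- At height 0 the slope at (x, y) is (m/2)⟨T(x, y), (x, y)⟩ = m⟨x, y⟩, and ⟨x, y⟩ is 1/2 or 0
according to whether e_j is e_0. -/
theorem twistSlope_torusPoint (m : ℝ) (j : Fin (n + 1)) :
    twistSlope (blockConj n) (blockSwap n) m 0 (torusPoint j) = if j = 0 then m / 2 else 0 := by
  have h : (√2)⁻¹ * (√2)⁻¹ = (2 : ℝ)⁻¹ := by
    rw [← mul_inv, Real.mul_self_sqrt (by norm_num)]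
  have h5 : (torusPoint j).snd = 0 := rfl
  rw [twistSlope, rotatedReflection_quarter_apply, h5, mul_zero, add_zero, Real.sin_zero,
    Real.cos_zero, neg_zero, zero_smul, zero_add, one_smul, inner_doubleSpace]
  split_ifs with hj
  · subst hj
    simp [torusPoint, Pi.single_apply, h]
    ring
  · simp [torusPoint, Pi.single_apply, hj, Ne.symm hj]

theorem isTwistCompatible_oddSphere :
    IsTwistCompatible (oddSphere n) (fun (_ : Fin 1) (x : DoubleSpace n) => x) (blockConj n)
      (blockSwap n) := fun _ _ _ h _ => ⟨h, h⟩

theorem isTwistCompatible_univ :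
    IsTwistCompatible (Set.univ : Set (DoubleSpace n))
      (Fin.elim0 : Fin 0 → DoubleSpace n → DoubleSpace n) (blockConj n) (blockSwap n) :=
  fun _ _ _ _ i => i.elim0

theorem finrank_doubleSpace : Module.finrank ℝ (DoubleSpace n) = 2 * n + 2 := by
  simp [DoubleSpace]
  ring

/-- On the sphere the open condition x ≠ 0 is automatic, so only closed conditions remain. -/
theorem isClosed_twistHypersurface_oddSphere (m : ℝ) :
    IsClosed (twistHypersurface (oddSphere n) (blockConj n) (blockSwap n) m 0) := by
  have h : twistHypersurface (oddSphere n) (blockConj n) (blockSwap n) m 0 =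
      (fun p : WithLp 2 (DoubleSpace n × ℝ) => p.fst) ⁻¹' Metric.sphere 0 1 ∩
        twistFunction (blockConj n) (blockSwap n) m 0 ⁻¹' {0} := by
    ext p
    exact ⟨fun h => ⟨h.1, h.2.2⟩, fun h => ⟨h.1,
      ne_zero_of_mem_unit_sphere (⟨_, h.1⟩ : Metric.sphere (0 : DoubleSpace n) 1), h.2⟩⟩
  rw [h]
  exact (Metric.isClosed_sphere.preimage continuous_withLp_fst).inter
    (isClosed_singleton.preimage (contDiff_twistFunction m 0).continuous)

theorem isProperMap_inclusion {X : Type*} [TopologicalSpace X] {s t : Set X} (h : s ⊆ t)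
    (hs : IsClosed s) : IsProperMap (Set.inclusion h) := by
  refine Topology.IsClosedEmbedding.isProperMap ⟨Topology.IsEmbedding.inclusion h, ?_⟩
  rw [Set.range_inclusion]
  exact hs.preimage continuous_subtype_val

theorem isVerticalHelicoid_of_torusPoint_mem (hn : 1 ≤ n) {m : ℝ} (hm : m ≠ 0) {c : ℕ}
    {M U : Set (DoubleSpace n)} {h : Fin c → DoubleSpace n → ℝ}
    {y : Fin c → DoubleSpace n → DoubleSpace n} (hM : IsOrthogonalLevelSet M U h y)
    (hy : IsTwistCompatible M y (blockConj n) (blockSwap n)) (hc : c ≤ 1)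
    (hmem : oddSphere n ⊆ M) :
    IsVerticalHelicoid M (twistHypersurface M (blockConj n) (blockSwap n) m 0) := by
  have hp : ∀ j, torusPoint j ∈ twistHypersurface M (blockConj n) (blockSwap n) m 0 := fun j =>
    ⟨hmem (torusPoint_mem m j).1, (torusPoint_mem m j).2⟩
  refine isCliffordPair_block.isVerticalHelicoid hM hy (by rw [finrank_doubleSpace]; omega)
    ⟨_, hp (Fin.last n), ?_⟩ ⟨_, hp 0, ?_⟩
  -- The last index differs from 0 exactly because n ≥ 1.
  · rw [twistSlope_torusPoint, if_neg]
    rw [Fin.ext_iff, Fin.val_last, Fin.val_zero]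
    omega
  · rw [twistSlope_torusPoint, if_pos rfl]
    exact div_ne_zero hm two_ne_zero

theorem containsOpenZeroMeanIsocurved_of_torusPoint_mem {m : ℝ} (hm : 2 < m) {c : ℕ}
    {M U : Set (DoubleSpace n)} {h : Fin c → DoubleSpace n → ℝ}
    {y : Fin c → DoubleSpace n → DoubleSpace n} (hM : IsOrthogonalLevelSet M U h y)
    (hy : IsTwistCompatible M y (blockConj n) (blockSwap n)) (hc : c ≤ 1)
    (hmem : oddSphere n ⊆ M) :
    ContainsOpenZeroMeanIsocurved M
      (twistHypersurface M (blockConj n) (blockSwap n) m 0) := by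
  refine ⟨_, isOpen_steepRegion,
    ⟨torusPoint 0, ⟨hmem (torusPoint_mem m 0).1, (torusPoint_mem m 0).2⟩, ?_⟩,
    isCliffordPair_block.isZeroMeanIsocurved hM hy (by rw [finrank_doubleSpace]; omega)⟩
  have h1 : ⟪(torusPoint (0 : Fin (n + 1))).fst, (torusPoint (0 : Fin (n + 1))).fst⟫ = 1 :=
    (mem_unit_sphere_iff_inner _).1 (torusPoint_mem m 0).1
  rw [steepRegion, Set.mem_ofPred_eq, h1, twistSlope_torusPoint, if_pos rfl]
  -- The steepness condition at this point is 1 < (m/2)².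
  nlinarith

end CliffordTorus

/-! ### The four assertions -/

theorem mainTheorem5 (n : ℕ) (hn : 1 ≤ n) :
    (∀ a k : ℝ, 0 < a → 0 < k →
      IsProperlyEmbeddedHypersurface (cylinder (oddSphere n)) (twistedCliffordTorus n a k) ∧
      IsVerticalHelicoid (oddSphere n) (twistedCliffordTorus n a k)) ∧
    (∀ a : ℝ, 0 < a → ∃ k : ℝ, 0 < k ∧
      ContainsOpenZeroMeanIsocurved (oddSphere n) (twistedCliffordTorus n a k)) ∧
    (∀ a k : ℝ, 0 < a → 0 < k →
      IsEmbeddedHypersurface (cylinder Set.univ) (twistedCliffordCone n a k) ∧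
      IsVerticalHelicoid Set.univ (twistedCliffordCone n a k)) ∧
    (∀ a : ℝ, 0 < a → ∃ k : ℝ, 0 < k ∧
      ContainsOpenZeroMeanIsocurved Set.univ (twistedCliffordCone n a k)) := by
  -- The choice k = 2a gives speed 2k/a = 4, above the threshold 2.
  have hm : ∀ a : ℝ, 0 < a → 2 < 2 * (2 * a) / a := fun a ha => by
    rw [lt_div_iff₀ ha]
    linarith
  refine ⟨fun a k ha hk => ?_, fun a ha => ⟨2 * a, by positivity, ?_⟩, fun a k ha hk => ?_,
    fun a ha => ⟨2 * a, by positivity, ?_⟩⟩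
  · rw [twistedCliffordTorus_eq ha]
    have h : IsVerticalHelicoid (oddSphere n) _ := isVerticalHelicoid_of_torusPoint_mem hn
      (m := 2 * k / a) (by positivity) isOrthogonalLevelSet_sphere isTwistCompatible_oddSphere
      le_rfl subset_rfl
    exact ⟨⟨h.hypersurface, h.hypersurface.1,
      isProperMap_inclusion _ (isClosed_twistHypersurface_oddSphere _)⟩, h⟩
  · rw [twistedCliffordTorus_eq ha]
    exact containsOpenZeroMeanIsocurved_of_torusPoint_mem (hm a ha) isOrthogonalLevelSet_sphere
      isTwistCompatible_oddSphere le_rfl subset_rfl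
  · rw [twistedCliffordCone_eq ha]
    have h : IsVerticalHelicoid Set.univ _ := isVerticalHelicoid_of_torusPoint_mem hn
      (m := 2 * k / a) (by positivity) isOrthogonalLevelSet_univ isTwistCompatible_univ
      zero_le_one (Set.subset_univ _)
    exact ⟨h.hypersurface, h⟩
  · rw [twistedCliffordCone_eq ha]
    exact containsOpenZeroMeanIsocurved_of_torusPoint_mem (hm a ha) isOrthogonalLevelSet_univ
      isTwistCompatible_univ zero_le_one (Set.subset_univ _)
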